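/- **Setting.** A document $D$ is an ordered rooted tree whose nodes (data nodes) carry tags; its depth $d(D)$ is the number of its levels. Each data node has a containment label $[left:right, level]$, from which the ancestor–descendant (AD) and parent–child (PC) relationships are read off. A twig pattern query (TPQ) $Q$ is an ordered rooted tree whose nodes carry tags, whose edges are marked AD or PC, and some of whose nodes are output query nodes. The stream of a query node is the list, in document order, of all data nodes with its tag; it is recursive if it contains two data nodes in the AD relationship. An output match of $Q$ in $D$ is the restriction to the output query nodes of an assignment of data nodes to query nodes that respects tags and edges. The query core consists of the output query nodes and all query nodes on paths between two output query nodes. For a query core node $q$, the constraining subquery $\Pi_q$ consists of $q$ and the non-output query nodes connected with $q$ by edges that do not lie on a path between two output query nodes; it is a TPQ with the single output query node $q$. **The binary join approach** processes $Q$ by a fully pipelined plan, in which every operator reads its inputs item by item on demand. - The plan of $\Pi_q$ (BuildPlanCons) starts from the index scan of the stream of $q$ and, for each neighbor $u$ of $q$, in an arbitrary fixed order, filters the current plan $P$ by the recursively built plan $P_u$ of $u$ without $q$: with the descendant-filtering semi-join of $T_a=P_u$, $T_d=P$ if $u$ is the parent of $q$, and with the ancestor-filtering semi-join of $T_a=P$,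 $T_d=P_u$ if $u$ is a child of $q$. The AD semi-joins use no stack; the PC semi-joins are the simplifications of the stack-based joins StackTreeDesc and StackTreeAnc below. - The plan of $Q$ (BuildPlanCore) starts at the root $q$ of the core with the plan $P$ of $\Pi_q$. For each child $c$ of $q$ in the core, in order: if $c$ is an output query node, then $P$ is joined with the recursively built plan of $c$ by the ancestor-sorted stack-based partial join StackTreeAnc. Otherwise the plan $R$ of $\Pi_c$ is extended downwards along the core, by descendant-sorted stack-based partial joins StackTreeDesc that keep the columns of $c$ and of the newly joined plan, with the plans of the constraining subqueries of the following non-output core nodes and finally with the recursively built plan of the next output query node $o$; then $P$ is joined with $R$ by StackTreeAncSrt, i.e. StackTreeAnc with the AD relationship on the columns of $q$ and $o$, outputting a joined tuple if and only if the columns of $q$ and $c$ satisfy the relationship of the edge $(q,c)$, and dropping the column of $c$. Time is the number of elementary steps of all operators of the plan. Space is the maximum, over the run, of the memory in use by all operators together (stacks, self- and inherited-lists, buffered current items, pointers), excluding the index and the delivered output. **Optimality.** For a class $\mathcal D$ of documents, the binary join approach is *optimal* for a TPQ $Q$ on $\mathcal D$ if there is a constant $C$ such that for every $D\in\mathcal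 D$ the plan of $Q$ runs on $D$ in time at most $C\,(\sum_{q} |T_q| + |\mathrm{out}| + 1)$ and in space at most $C\,d(D)$, where $T_q$ is the stream of the query node $q$ in $D$, the sum is over all query nodes of $Q$, and $|\mathrm{out}|$ is the number of output matches of $Q$ in $D$. **Theorem.** Let $Q$ be a TPQ with at least two output query nodes and let $\mathcal D$ be a class of documents. Suppose that (i) for every query core node $q$, the binary join approach is optimal for the constraining subquery $\Pi_q$ on $\mathcal D$; (ii) the query core is a path going downwards from its root, i.e. every query core node has at most one child in the core; (iii) for every $D\in\mathcal D$ and every query core node $q$, the stream of $q$ in $D$ is not recursive. Then the binary join approach is optimal for $Q$ on $\mathcal D$. -/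

import Mathlib

namespace TwigJoin

/-! ## Documents, node labels and streams -/

/-- An XML document: an ordered rooted tree whose nodes carry tags. -/
inductive XTree (Tag : Type*) where
  | node : Tag → List (XTree Tag) → XTree Tag

/-- A label `[left : right, level]` of the containment labeling scheme. -/
structure Label where
  left : ℕ
  right : ℕ
  level : ℕ

instance : Inhabited Label := ⟨⟨0, 0, 0⟩⟩

/-- The XPath relationships ancestor-descendant and parent-child. -/
inductive Rel where
  | AD
  | PC

/-- `a` is an ancestor of `d`: the interval of `a` contains the interval of `d`. -/
def Label.IsAncestor (a d : Label) : Prop := a.left < d.left ∧ d.right < a.right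

instance (a d : Label) : Decidable (a.IsAncestor d) :=
  inferInstanceAs (Decidable (_ ∧ _))

/-- `α.Holds a d`: the node `a` is an ancestor (`AD`) or the parent (`PC`) of `d`. -/
def Rel.Holds : Rel → Label → Label → Prop
  | .AD, a, d => a.IsAncestor d
  | .PC, a, d => a.IsAncestor d ∧ a.level + 1 = d.level

instance (α : Rel) (a d : Label) : Decidable (α.Holds a d) :=
  match α with
  | .AD => inferInstanceAs (Decidable (a.IsAncestor d))
  | .PC => inferInstanceAs (Decidable (a.IsAncestor d ∧ a.level + 1 = d.level))

mutual
/-- The number of data nodes of a tree. -/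
def XTree.size {Tag : Type*} : XTree Tag → ℕ
  | .node _ cs => 1 + XTree.sizeList cs
/-- The number of data nodes of a list of trees. -/
def XTree.sizeList {Tag : Type*} : List (XTree Tag) → ℕ
  | [] => 0
  | t :: ts => XTree.size t + XTree.sizeList ts
end

mutual
/-- The data nodes (tag and label) of a tree in pre-order, the `left` value of the root being `l`
and its level being `lev`.  A subtree with `s` nodes uses `2 * s` consecutive numbers. -/
def XTree.labelFrom {Tag : Type*} : XTree Tag → ℕ → ℕ → List (Tag × Label)
  | .node t cs, l, lev =>
      (t, ⟨l, l + 2 * XTree.sizeList cs + 1, lev⟩) :: XTree.labelListFrom cs (l + 1) (lev + 1)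
/-- The same for a list of sibling trees. -/
def XTree.labelListFrom {Tag : Type*} : List (XTree Tag) → ℕ → ℕ → List (Tag × Label)
  | [], _, _ => []
  | t :: ts, l, lev =>
      XTree.labelFrom t l lev ++ XTree.labelListFrom ts (l + 2 * XTree.size t) lev
end

/-- The labeled data nodes of a document in document order; the root is `[1 : 2 * size, 1]`. -/
def XTree.dataNodes {Tag : Type*} (D : XTree Tag) : List (Tag × Label) := D.labelFrom 1 1

/-- The depth of a document: the maximal level of a data node (a single node has depth `1`). -/
def XTree.depth {Tag : Type*} (D : XTree Tag) : ℕ :=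
  (D.dataNodes.map fun x => x.2.level).foldr max 0

/-- The stream of a tag: all data nodes with that tag, in document order. -/
def XTree.stream {Tag : Type*} [DecidableEq Tag] (D : XTree Tag) (t : Tag) : List Label :=
  (D.dataNodes.filter fun x => x.1 = t).map fun x => x.2

/-- A stream is recursive if some of its data nodes are in the AD relationship. -/
def IsRecursive (T : List Label) : Prop := ∃ a ∈ T, ∃ d ∈ T, a.IsAncestor d

/-! ## Cursors: the cost model of pipelined operators -/

/-- A row of a table of node labels.  A list of data nodes is a table with one column. -/
abbrev Tuple := List Label

/-- The entry of a tuple in column `i` (columns are counted from `0`). -/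
def Tuple.col (t : Tuple) (i : ℕ) : Label := List.getD t i default

/-- The number of node labels stored in a list of tuples. -/
def storage (l : List Tuple) : ℕ := (l.map List.length).sum

/-- Result of one elementary step of a running plan. -/
inductive Step (S : Type) where
  | silent : S → Step S
  | emit : Tuple → S → Step S
  | done : Step S

/-- A running plan, read item by item by its consumer: a deterministic machine that, in each
elementary step, works silently, emits one tuple, or reports that it is finished.
`size` is the amount of memory in use. -/
structure Cursor where
  State : Type
  init : State
  step : State → Step State
  size : State → ℕ

/-- The state after `n` elementary steps; `none` once the cursor has finished. -/
def Cursor.after (c : Cursor) : ℕ → Option c.State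
  | 0 => some c.init
  | n + 1 =>
    match c.after n with
    | none => none
    | some s =>
      match c.step s with
      | .silent s' => some s'
      | .emit _ s' => some s'
      | .done => none

/-- The cursor finishes within `T` elementary steps. -/
def Cursor.TimeLE (c : Cursor) (T : ℕ) : Prop := c.after T = none

/-- At every moment of its run the cursor uses at most `M` memory cells. -/
def Cursor.SpaceLE (c : Cursor) (M : ℕ) : Prop := ∀ n s, c.after n = some s → c.size s ≤ M

/-- Index scan over a list of labels.  The list itself belongs to the index: only the position in
it is stored. -/
def Cursor.scan (T : List Label) : Cursor where
  State := List Label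
  init := T
  step := fun l =>
    match l with
    | [] => .done
    | x :: l' => .emit [x] l'
  size := fun _ => 1

/-- Result of one step of a binary operator: continue, possibly advancing the first and/or the
second input and possibly emitting a tuple, or halt. -/
inductive OpStep (S : Type) where
  | go (advA advD : Bool) (out : Option Tuple) (s : S) : OpStep S
  | halt : OpStep S

/-- A binary operator with constant work per step.  It sees the current item of each of its two
inputs (`none` if that input is finished). -/
structure BinOp where
  State : Type
  init : State
  step : State → Option Tuple → Option Tuple → OpStep State
  size : State → ℕ

/-- An input of a running binary operator: the next item is still to be fetched from the child,
or the current item is available, or the child is finished. -/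
inductive Feed (S : Type) where
  | need : S → Feed S
  | item : Tuple → S → Feed S
  | eof : Feed S

/-- The current item of an input. -/
def Feed.current {S : Type} : Feed S → Option Tuple
  | .item t _ => some t
  | _ => none

/-- `advance`: the current item is dropped and the next one is requested. -/
def Feed.advance {S : Type} : Feed S → Feed S
  | .item _ s => .need s
  | f => f

/-- Memory used by an input: that of the child and the buffered current item. -/
def Feed.size {S : Type} (size : S → ℕ) : Feed S → ℕ
  | .need s => size s
  | .item t s => t.length + size s
  | .eof => 0

/-- One elementary step of a child from which an item is requested. -/
def Cursor.pull (c : Cursor) (s : c.State) : Feed c.State :=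
  match c.step s with
  | .silent s' => .need s'
  | .emit t s' => .item t s'
  | .done => .eof

/-- Pipelined execution of a binary operator on two running plans.  Children are run on demand;
all their steps and all their memory are accounted for. -/
def Cursor.binary (O : BinOp) (A B : Cursor) : Cursor where
  State := O.State × Feed A.State × Feed B.State
  init := (O.init, .need A.init, .need B.init)
  step := fun st =>
    match st with
    | (o, .need s, fd) => .silent (o, A.pull s, fd)
    | (o, fa, .need s) => .silent (o, fa, B.pull s)
    | (o, fa, fd) =>
      match O.step o fa.current fd.current with
      | .halt => .done
      | .go advA advD out o' =>
        let st' := (o', if advA then fa.advance else fa, if advD then fd.advance else fd)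
        match out with
        | none => .silent st'
        | some t => .emit t st'
  size := fun st => 1 + O.size st.1 + st.2.1.size A.size + st.2.2.size B.size

/-! ## Semi-joins for the AD relationship (without a stack) -/

/-- Descendant-filtering semi-join for AD. -/
def semiDescAD : BinOp where
  State := Unit
  init := ()
  step := fun _ a d =>
    match a, d with
    | some a, some d =>
      if (d.col 0).left ≤ (a.col 0).left then .go false true none ()
      else if (d.col 0).right < (a.col 0).right then .go false true (some d) ()
      else .go true false none ()
    | _, _ => .halt
  size := fun _ => 0

/-- Ancestor-filtering semi-join for AD. -/
def semiAncAD : BinOp where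
  State := Unit
  init := ()
  step := fun _ a d =>
    match a, d with
    | some a, some d =>
      if (d.col 0).left ≤ (a.col 0).left then .go false true none ()
      else if (d.col 0).right < (a.col 0).right then .go true false (some a) ()
      else .go true false none ()
    | _, _ => .halt
  size := fun _ => 0

/-! ## The merge common to the stack-based joins -/

/-- What a stack-based join does next. -/
inductive Move where
  | pop : Move
  | push : Tuple → Move
  | probe : Tuple → Move
  | halt : Move

/-- The current item of an input starts after position `r`; a finished input counts as starting
at infinity. -/
def startsAfter (r i : ℕ) : Option Tuple → Bool
  | none => true
  | some t => decide (r < (t.col i).left)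

/-- The next move, given the join columns `i`, `j`, the join label on top of the stack and the
current items.  The top is popped once both current items start after its end; otherwise the input
whose item starts first is served: an item of `T_a` is pushed, an item of `T_d` is compared with the
stack.  The join halts when both inputs are finished and the stack is empty. -/
def stackMove (i j : ℕ) (top : Option Label) (a d : Option Tuple) : Move :=
  if top.any (fun l => startsAfter l.right i a && startsAfter l.right j d) then .pop
  else
    match a, d with
    | none, none => .halt
    | some a, none => .push a
    | none, some d => .probe d
    | some a, some d => if (a.col i).left < (d.col j).left then .push a else .probe d

/-! ## Semi-joins for the PC relationship

The input `T_a` is a list without repetitions, so that the parent of the current item of `T_d`,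
if it is on the stack, is the top entry.  The stacks are written with the top entry first. -/

/-- Descendant-filtering semi-join for PC. -/
def semiDescPC : BinOp where
  State := List Tuple
  init := []
  step := fun st a d =>
    match stackMove 0 0 (st.head?.map fun e => e.col 0) a d with
    | .halt => .halt
    | .pop => .go false false none st.tail
    | .push a => .go true false none (a :: st)
    | .probe d =>
      let hit : Bool := st.head?.any fun e => decide (Rel.PC.Holds (e.col 0) (d.col 0))
      .go false true (if hit then some d else none) st
  size := storage

/-- A stack entry of the ancestor-filtering semi-join for PC.  The self-list of an entry consists of
the entry itself or is empty, and is stored as the flag `hit`. -/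
structure SemiEntry where
  tup : Tuple
  hit : Bool
  inherited : List Tuple

/-- The self-list of an entry. -/
def SemiEntry.self (e : SemiEntry) : List Tuple := if e.hit then [e.tup] else []

/-- Memory of the ancestor-filtering semi-join for PC: the stack, and the list of nodes that are
waiting to be output. -/
structure SemiAncState where
  stack : List SemiEntry
  pending : List Tuple

/-- Ancestor-filtering semi-join for PC.  The bottom entry is output as soon as it is hit; a hit
entry that is not at the bottom has to wait in the list inherited by the entry below. -/
def semiAncPC : BinOp where
  State := SemiAncState
  init := ⟨[], []⟩
  step := fun s a d =>
    match s.pending with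
    | t :: rest => .go false false (some t) ⟨s.stack, rest⟩
    | [] =>
      match stackMove 0 0 (s.stack.head?.map fun e => e.tup.col 0) a d with
      | .halt => .halt
      | .push a => .go true false none ⟨⟨a, false, []⟩ :: s.stack, []⟩
      | .pop =>
        match s.stack with
        | [] => .go false false none s
        | [e] => .go false false none ⟨[], e.inherited⟩
        | e :: e' :: rest =>
          .go false false none
            ⟨{ e' with inherited := e'.inherited ++ (e.self ++ e.inherited) } :: rest, []⟩
      | .probe d =>
        match s.stack with
        | [] => .go false true none s
        | e :: rest =>
          if Rel.PC.Holds (e.tup.col 0) (d.col 0) then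
            .go false true (if rest.isEmpty && !e.hit then some e.tup else none)
              ⟨{ e with hit := true } :: rest, []⟩
          else .go false true none s
  size := fun s =>
    (s.stack.map fun e => e.tup.length + 1 + storage e.inherited).sum + storage s.pending

/-! ## Partial joins

The stacks are written with the bottom entry first.  `test` decides whether a tuple on the stack is
joined with the current tuple of `T_d`, and `out` is the joined tuple. -/

/-- Memory of the descendant-sorted partial join: the stack, and, while the current item of `T_d` is
compared with the stack, the position reached in the stack. -/
structure DescState where
  stack : List Tuple
  ptr : Option ℕ

/-- The descendant-sorted partial join. -/
def stackTreeDesc (i j : ℕ) (test : Tuple → Tuple → Bool) (out : Tuple → Tuple → Tuple) :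
    BinOp where
  State := DescState
  init := ⟨[], none⟩
  step := fun s a d =>
    match s.ptr with
    | some k =>
      match s.stack[k]?, d with
      | some e, some d =>
          .go false false (if test e d then some (out e d) else none) ⟨s.stack, some (k + 1)⟩
      | _, _ => .go false true none ⟨s.stack, none⟩
    | none =>
      match stackMove i j (s.stack.getLast?.map fun e => e.col i) a d with
      | .halt => .halt
      | .pop => .go false false none ⟨s.stack.dropLast, none⟩
      | .push a => .go true false none ⟨s.stack ++ [a], none⟩
      | .probe _ => .go false false none ⟨s.stack, some 0⟩
  size := fun s => storage s.stack + 1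

/-- A stack entry of the ancestor-sorted partial join: a tuple with its self-list and its
inherited-list. -/
structure Entry where
  tup : Tuple
  self : List Tuple
  inherited : List Tuple

/-- Memory of the ancestor-sorted partial join: the stack, the position reached in the stack, and the
list of tuples that are waiting to be output. -/
structure AncState where
  stack : List Entry
  ptr : Option ℕ
  pending : List Tuple

/-- The ancestor-sorted partial join.  Tuples joined with the bottom entry are output at once, those
joined with another entry are put into its self-list.  A popped entry hands its self-list and its
inherited-list down to the inherited-list of the entry below; the inherited-list of a popped bottom
entry is output.  (Lists are linked lists, so appending two lists is one step.) -/
def stackTreeAnc (i j : ℕ) (test : Tuple → Tuple → Bool) (out : Tuple → Tuple → Tuple) :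
    BinOp where
  State := AncState
  init := ⟨[], none, []⟩
  step := fun s a d =>
    match s.pending with
    | t :: rest => .go false false (some t) ⟨s.stack, s.ptr, rest⟩
    | [] =>
      match s.ptr with
      | some k =>
        match s.stack[k]?, d with
        | some e, some d =>
          if test e.tup d then
            if k = 0 then .go false false (some (out e.tup d)) ⟨s.stack, some (k + 1), []⟩
            else
              .go false false none
                ⟨s.stack.set k { e with self := e.self ++ [out e.tup d] }, some (k + 1), []⟩
          else .go false false none ⟨s.stack, some (k + 1), []⟩
        | _, _ => .go false true none ⟨s.stack, none, []⟩
      | none =>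
        match stackMove i j (s.stack.getLast?.map fun e => e.tup.col i) a d with
        | .halt => .halt
        | .push a => .go true false none ⟨s.stack ++ [⟨a, [], []⟩], none, []⟩
        | .probe _ => .go false false none ⟨s.stack, some 0, []⟩
        | .pop =>
          match s.stack.getLast?, s.stack.dropLast.getLast? with
          | some e, some e' =>
            .go false false none
              ⟨s.stack.dropLast.dropLast ++
                [{ e' with inherited := e'.inherited ++ (e.self ++ e.inherited) }], none, []⟩
          | some e, none => .go false false none ⟨[], none, e.inherited⟩
          | none, _ => .go false false none s
  size := fun s =>
    (s.stack.map fun e => e.tup.length + storage e.self + storage e.inherited).sum +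
      storage s.pending + 1

/-! ## Query plans -/

/-- A projection mask: `M c` says whether column `c` (counted from `0`) is kept. -/
abbrev Mask := ℕ → Bool

/-- The mask `1*`. -/
def Mask.all : Mask := fun _ => true
/-- The mask `10*`. -/
def Mask.first : Mask := fun c => decide (c = 0)
/-- The mask `01*`. -/
def Mask.rest : Mask := fun c => decide (c ≠ 0)

/-- The projection of a tuple. -/
def project : Mask → Tuple → Tuple
  | _, [] => []
  | M, x :: t => if M 0 then x :: project (fun c => M (c + 1)) t
      else project (fun c => M (c + 1)) t

/-- Query plans: index scans, the two filtering variants of the semi-join, and the partial joins with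
their masks, join columns (counted from `0`) and relationship; in each binary operator the
first input is `T_a` and the second one is `T_d`. -/
inductive Plan (Tag : Type*) where
  | scan (t : Tag) : Plan Tag
  | semiDesc (α : Rel) (Pa Pd : Plan Tag) : Plan Tag
  | semiAnc (α : Rel) (Pa Pd : Plan Tag) : Plan Tag
  | joinDesc (Ma Md : Mask) (i j : ℕ) (α : Rel) (Pa Pd : Plan Tag) : Plan Tag
  | joinAnc (Ma Md : Mask) (i j : ℕ) (α : Rel) (Pa Pd : Plan Tag) : Plan Tag
  | joinAncSrt (Ma Md : Mask) (i j : ℕ) (α : Rel) (k : ℕ) (Pa Pd : Plan Tag) : Plan Tag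

/-- The running plan on a document.  The join with the secondary relationship test joins the columns
`i` and `j` by AD and outputs a joined tuple if and only if `α` holds between the columns `i`
and `k`. -/
def Plan.exec {Tag : Type*} [DecidableEq Tag] (D : XTree Tag) : Plan Tag → Cursor
  | .scan t => Cursor.scan (D.stream t)
  | .semiDesc .AD Pa Pd => Cursor.binary semiDescAD (Pa.exec D) (Pd.exec D)
  | .semiDesc .PC Pa Pd => Cursor.binary semiDescPC (Pa.exec D) (Pd.exec D)
  | .semiAnc .AD Pa Pd => Cursor.binary semiAncAD (Pa.exec D) (Pd.exec D)
  | .semiAnc .PC Pa Pd => Cursor.binary semiAncPC (Pa.exec D) (Pd.exec D)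
  | .joinDesc Ma Md i j α Pa Pd =>
      Cursor.binary
        (stackTreeDesc i j (fun a d => decide (α.Holds (a.col i) (d.col j)))
          (fun a d => project Ma a ++ project Md d))
        (Pa.exec D) (Pd.exec D)
  | .joinAnc Ma Md i j α Pa Pd =>
      Cursor.binary
        (stackTreeAnc i j (fun a d => decide (α.Holds (a.col i) (d.col j)))
          (fun a d => project Ma a ++ project Md d))
        (Pa.exec D) (Pd.exec D)
  | .joinAncSrt Ma Md i j α k Pa Pd =>
      Cursor.binary
        (stackTreeAnc i j
          (fun a d => decide ((a.col i).IsAncestor (d.col j) ∧ α.Holds (a.col i) (d.col k)))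
          (fun a d => project Ma a ++ project Md d))
        (Pa.exec D) (Pd.exec D)

/-! ## Twig pattern queries -/

/-- The data of a query: query nodes named by natural numbers, for each query node its parent
(if that is a query node), the relationship to its parent, and its tag, and the set of output
query nodes.  The order of siblings is the order of their numbers. -/
structure Query (Tag : Type*) where
  nodes : Finset ℕ
  parent : ℕ → Option ℕ
  rel : ℕ → Rel
  tag : ℕ → Tag
  outputs : Finset ℕ

namespace Query

variable {Tag : Type*}

/-- The query is a twig pattern query: its nodes form a rooted tree, numbered such that parents come
before their children (as in a pre-order traversal), and some of them are output query nodes. -/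
structure IsTPQ (Q : Query Tag) : Prop where
  outputs_subset : Q.outputs ⊆ Q.nodes
  outputs_nonempty : Q.outputs.Nonempty
  tree : ∃ r ∈ Q.nodes, (∀ p ∈ Q.nodes, Q.parent r ≠ some p) ∧
    ∀ v ∈ Q.nodes, v ≠ r → ∃ p ∈ Q.nodes, p < v ∧ Q.parent v = some p

/-- The undirected graph of the query. -/
def graph (Q : Query Tag) : SimpleGraph ℕ where
  Adj u v := u ∈ Q.nodes ∧ v ∈ Q.nodes ∧ u ≠ v ∧ (Q.parent v = some u ∨ Q.parent u = some v)
  symm := ⟨fun _ _ h => ⟨h.2.1, h.1, h.2.2.1.symm, h.2.2.2.symm⟩⟩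
  loopless := ⟨fun _ h => h.2.2.1 rfl⟩

/-- The edges lying on a path between two output query nodes. -/
def coreEdges (Q : Query Tag) : Set (Sym2 ℕ) :=
  {e | ∃ o₁ ∈ Q.outputs, ∃ o₂ ∈ Q.outputs, ∃ p : Q.graph.Walk o₁ o₂, p.IsPath ∧ e ∈ p.edges}

open Classical in
/-- The query core nodes: the output query nodes and the query nodes lying on a path between two
output query nodes. -/
noncomputable def coreNodes (Q : Query Tag) : Finset ℕ :=
  Q.nodes.filter fun v => v ∈ Q.outputs ∨
    ∃ o₁ ∈ Q.outputs, ∃ o₂ ∈ Q.outputs, ∃ p : Q.graph.Walk o₁ o₂, p.IsPath ∧ v ∈ p.support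

open Classical in
/-- The constraining subquery of `q`: formed of `q` and the non-output query nodes connected with `q`
by edges not lying on a path between two output query nodes.  The constrained node `q` is its output
query node. -/
noncomputable def constraining (Q : Query Tag) (q : ℕ) : Query Tag where
  nodes := Q.nodes.filter fun v =>
    v = q ∨ v ∉ Q.outputs ∧ (Q.graph.deleteEdges Q.coreEdges).Reachable q v
  parent := Q.parent
  rel := Q.rel
  tag := Q.tag
  outputs := {q}

open Classical in
/-- The children of `v` in the query core, in their order. -/
noncomputable def coreChildren (Q : Query Tag) (v : ℕ) : List ℕ :=
  (Q.coreNodes.filter fun c => Q.parent c = some v).sort (· ≤ ·)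

/-- The root of the query core: its node with the smallest number. -/
noncomputable def coreRoot (Q : Query Tag) : ℕ := sInf (Q.coreNodes : Set ℕ)

/-- The query core is a path from its root downwards: no query core node has more than one child in
the query core. -/
def CoreIsPath (Q : Query Tag) : Prop := ∀ v ∈ Q.coreNodes, (Q.coreChildren v).length ≤ 1

/-- The neighbors (children and parent) of `v` among the query nodes in `S`. -/
def neighbors (Q : Query Tag) (S : Finset ℕ) (v : ℕ) : List ℕ :=
  ((S.erase v).filter fun u => Q.parent u = some v ∨ Q.parent v = some u).sort (· ≤ ·)

end Query

/-! ## Building the plan -/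

/-- The order in which the neighbors of a query node are processed when the plan of a constraining
subquery is built; any order is allowed. -/
structure NeighborOrder where
  order : ℕ → List ℕ → List ℕ
  perm : ∀ v l, (order v l).Perm l

namespace Query

variable {Tag : Type*}

/-- `BuildPlanCons` for the query node `v` of the query restricted to `S`.  The neighbors of `v` are
processed without `v`.  The first argument bounds the depth of the recursion (the number of
elements of `S` is enough). -/
def buildCons (ord : NeighborOrder) (Q : Query Tag) : ℕ → Finset ℕ → ℕ → Plan Tag
  | 0, _, v => .scan (Q.tag v)
  | f + 1, S, v =>
    (ord.order v (Q.neighbors S v)).foldl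
      (fun P u =>
        if Q.parent v = some u then .semiDesc (Q.rel v) (buildCons ord Q f (S.erase v) u) P
        else .semiAnc (Q.rel u) P (buildCons ord Q f (S.erase v) u))
      (.scan (Q.tag v))

/-- `BuildPlanCons` applied to the constraining subquery of `q`. -/
noncomputable def consPlan (ord : NeighborOrder) (Q : Query Tag) (q : ℕ) : Plan Tag :=
  (Q.constraining q).buildCons ord (Q.constraining q).nodes.card (Q.constraining q).nodes q

mutual
/-- `BuildPlanCore`.  The first numeric argument bounds the depth of the recursion (the number of
query nodes is enough). -/
noncomputable def buildCore (ord : NeighborOrder) (Q : Query Tag) : ℕ → ℕ → Plan Tag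
  | 0, q => Q.consPlan ord q
  | f + 1, q =>
    (Q.coreChildren q).foldl
      (fun P c =>
        if c ∈ Q.outputs then
          .joinAnc Mask.all Mask.all 0 0 (Q.rel c) P (buildCore ord Q f c)
        else
          .joinAncSrt Mask.all Mask.rest 0 1 (Q.rel c) 0 P
            (buildChain ord Q f (Q.consPlan ord c) 0 c))
      (Q.consPlan ord q)
/-- The inner loop of `BuildPlanCore`: it starts at a non-output query core node `d` and extends the
plan `R` down to the next output query node.  The index `i` is the join column in `R`. -/
noncomputable def buildChain (ord : NeighborOrder) (Q : Query Tag) :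
    ℕ → Plan Tag → ℕ → ℕ → Plan Tag
  | 0, R, _, _ => R
  | f + 1, R, i, d =>
    match (Q.coreChildren d).head? with
    | none => R
    | some d' =>
      if d' ∈ Q.outputs then
        .joinDesc Mask.first Mask.all i 0 (Q.rel d') R (buildCore ord Q f d')
      else
        buildChain ord Q f
          (.joinDesc Mask.first Mask.all i 0 (Q.rel d') R (Q.consPlan ord d')) 1 d'
end

/-- The plan by which the binary join approach processes the query. -/
noncomputable def plan (ord : NeighborOrder) (Q : Query Tag) : Plan Tag :=
  Q.buildCore ord Q.nodes.card Q.coreRoot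

/-! ## Size of input and output, optimality -/

variable [DecidableEq Tag]

/-- The size of the input: the sum of the sizes of the streams of all query nodes. -/
def inputSize (Q : Query Tag) (D : XTree Tag) : ℕ := ∑ v ∈ Q.nodes, (D.stream (Q.tag v)).length

/-- `m` assigns to every query node a data node with the right tag, such that all relationships
required by the edges are satisfied. -/
def IsCompleteMatch (Q : Query Tag) (D : XTree Tag) (m : ℕ → Label) : Prop :=
  (∀ v ∈ Q.nodes, m v ∈ D.stream (Q.tag v)) ∧
    ∀ v ∈ Q.nodes, ∀ p ∈ Q.nodes, Q.parent v = some p → (Q.rel v).Holds (m p) (m v)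

/-- The output matches: the complete matches projected to the output query nodes. -/
def outputMatches (Q : Query Tag) (D : XTree Tag) : Set (Q.outputs → Label) :=
  {f | ∃ m, Q.IsCompleteMatch D m ∧ ∀ v : Q.outputs, f v = m v}

/-- The size of the output: the number of output matches. -/
noncomputable def outputSize (Q : Query Tag) (D : XTree Tag) : ℕ := (Q.outputMatches D).ncard

/-- The binary join approach is optimal for `Q` on the documents of the class `𝒟`: the time is
linear in the size of the input and output, and the space is linear in the depth of the document. -/
def Optimal (ord : NeighborOrder) (Q : Query Tag) (𝒟 : Set (XTree Tag)) : Prop :=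
  ∃ C : ℕ, ∀ D ∈ 𝒟,
    ((Q.plan ord).exec D).TimeLE (C * (Q.inputSize D + Q.outputSize D + 1)) ∧
    ((Q.plan ord).exec D).SpaceLE (C * D.depth)

end Query

end TwigJoin

namespace TwigJoin

-- The stream of a core node is not recursive, so its labels are pairwise disjoint intervals in
-- document order (`XTree.stream_pairwise`). The plan of a constraining subquery only filters the
-- stream of its core node, hence delivers a sublist of that stream (`Query.buildCons_filters`). By
-- (i) it does so in linear time and in space proportional to the depth. This uses that the plan of
-- `Π_q` as a query in its own right is the subplan occurring in the plan of `Q`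
-- (`IsTPQ.plan_constraining`), and that `Π_q` has at most as many matches as the stream of `q` has
-- elements.
--
-- Consider a stack-based partial join whose first input has disjoint labels in the join column. Its
-- stack never holds more than one entry (`BinOp.joinsOnce_of_moves`). Each tuple of the second
-- input therefore meets at most one partner. The join takes a number of steps linear in its inputs,
-- delivers no more tuples than its second input, and needs only a constant number of cells for
-- tuples of bounded width. In the ancestor-sorted join the single entry is the bottom one, so its
-- results leave at once and no self-list or inherited-list is ever filled.
--
-- Since the core is a path, the plan of `Q` is a nest of such joins. The first input is always a
-- constraining plan or a chain plan `R`. Chain joins preserve disjointness in the newly joined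
-- column (`Plan.Disjoint.joinDesc_disjoint`), while tuples of `R` keep at most two columns.
-- Induction along the core (`CoreBounds.buildCore_buildChain`) adds up the costs, every
-- intermediate result having at most as many tuples as the input size. The depth of the nest
-- depends on `Q` only, and the resulting time bound is linear in the input size alone. Only time
-- and space are at stake; which tuples the plan delivers matters only as far as their number, width
-- and order.

/-! ## Complete runs of cursors -/

/-- From the state `s` the cursor finishes after exactly `T` steps, emits the list `L`, and never
uses more than `M` memory cells. -/
inductive Cursor.Yields (c : Cursor) (M : ℕ) : c.State → ℕ → List Tuple → Prop
  | done {s} : c.size s ≤ M → c.step s = .done → Yields c M s 1 []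
  | silent {s s' T L} : c.size s ≤ M → c.step s = .silent s' → Yields c M s' T L →
      Yields c M s (T + 1) L
  | emit {s t s' T L} : c.size s ≤ M → c.step s = .emit t s' → Yields c M s' T L →
      Yields c M s (T + 1) (t :: L)

/-- The whole run of the cursor takes at most `T` steps and `M` memory cells, and emits `L`. -/
def Cursor.Delivers (c : Cursor) (T M : ℕ) (L : List Tuple) : Prop :=
  ∃ T' ≤ T, c.Yields M c.init T' L

/-- Optimality bounds time and space without mentioning the emitted list. Since the cursor is
deterministic, a terminating run can be recorded step by step, which gives that list a name. -/
theorem Cursor.exists_yields (c : Cursor) {M : ℕ} (hM : c.SpaceLE M) (k : ℕ) :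
    ∀ n s, c.after n = some s → c.after (n + k) = none → ∃ T ≤ k, ∃ L, c.Yields M s T L := by
  induction k with
  | zero => intro n s h h'; simp [h] at h'
  | succ k ih =>
    intro n s h h'
    have hs := hM n s h
    rw [show n + (k + 1) = n + 1 + k by ring] at h'
    rcases hst : c.step s with s' | ⟨t, s'⟩ | _
    · obtain ⟨T, hT, L, hL⟩ := ih (n + 1) s' (by simp [Cursor.after, h, hst]) h'
      exact ⟨T + 1, by omega, L, .silent hs hst hL⟩
    · obtain ⟨T, hT, L, hL⟩ := ih (n + 1) s' (by simp [Cursor.after, h, hst]) h'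
      exact ⟨T + 1, by omega, _, .emit hs hst hL⟩
    · exact ⟨1, by omega, _, .done hs hst⟩

theorem Cursor.exists_delivers (c : Cursor) {T M : ℕ} (hT : c.TimeLE T) (hM : c.SpaceLE M) :
    ∃ L, c.Delivers T M L := by
  obtain ⟨T', h, L, hL⟩ := c.exists_yields hM T 0 c.init rfl (by
    simpa [Cursor.TimeLE] using hT)
  exact ⟨L, T', h, hL⟩

theorem Cursor.after_none_of_le (c : Cursor) {m n : ℕ} (h : m ≤ n) (hm : c.after m = none) :
    c.after n = none := by
  induction n, h using Nat.le_induction with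
  | base => exact hm
  | succ n _ ih => simp [Cursor.after, ih]

theorem Cursor.Yields.after_spec {c : Cursor} {M T : ℕ} {s : c.State} {L : List Tuple}
    (h : c.Yields M s T L) : ∀ n, c.after n = some s → c.after (n + T) = none ∧
      ∀ m s', c.after (n + m) = some s' → c.size s' ≤ M := by
  have aux : ∀ {s : c.State} {n : ℕ}, c.size s ≤ M → c.after n = some s →
      (∀ m s', c.after (n + 1 + m) = some s' → c.size s' ≤ M) →
      ∀ m s', c.after (n + m) = some s' → c.size s' ≤ M := by
    intro s n hs hn h m s' hm
    rcases m with _ | m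
    · simp only [Nat.add_zero, hn, Option.some.injEq] at hm
      exact hm ▸ hs
    · exact h m s' (by rwa [show n + 1 + m = n + (m + 1) by ring])
  induction h with
  | done hs hst =>
    intro n hn
    have h1 : c.after (n + 1) = none := by simp [Cursor.after, hn, hst]
    refine ⟨h1, aux hs hn fun m s' hm => ?_⟩
    rw [c.after_none_of_le (by omega) h1] at hm
    cases hm
  | silent hs hst _ ih =>
    intro n hn
    obtain ⟨h1, h2⟩ := ih (n + 1) (by simp [Cursor.after, hn, hst])
    exact ⟨by rwa [Nat.add_right_comm] at h1, aux hs hn h2⟩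
  | emit hs hst _ ih =>
    intro n hn
    obtain ⟨h1, h2⟩ := ih (n + 1) (by simp [Cursor.after, hn, hst])
    exact ⟨by rwa [Nat.add_right_comm] at h1, aux hs hn h2⟩

theorem Cursor.Delivers.timeLE {c : Cursor} {T M : ℕ} {L : List Tuple} (h : c.Delivers T M L) :
    c.TimeLE T := by
  obtain ⟨T', hT, h⟩ := h
  exact c.after_none_of_le hT (by simpa using (h.after_spec 0 rfl).1)

theorem Cursor.Delivers.spaceLE {c : Cursor} {T M : ℕ} {L : List Tuple} (h : c.Delivers T M L) :
    c.SpaceLE M := by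
  obtain ⟨T', hT, h⟩ := h
  intro n s hn
  exact (h.after_spec 0 rfl).2 n s (by simpa using hn)

theorem Cursor.Yields.mono {c : Cursor} {M M' T : ℕ} {s : c.State} {L : List Tuple}
    (h : c.Yields M s T L) (hM : M ≤ M') : c.Yields M' s T L := by
  induction h with
  | done hs hst => exact .done (hs.trans hM) hst
  | silent hs hst _ ih => exact .silent (hs.trans hM) hst ih
  | emit hs hst _ ih => exact .emit (hs.trans hM) hst ih

theorem Cursor.Delivers.mono {c : Cursor} {T T' M M' : ℕ} {L : List Tuple}
    (h : c.Delivers T M L) (hT : T ≤ T') (hM : M ≤ M') : c.Delivers T' M' L := by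
  obtain ⟨T₀, h₀, h⟩ := h
  exact ⟨T₀, h₀.trans hT, h.mono hM⟩

theorem Cursor.Yields.size_le {c : Cursor} {M T : ℕ} {s : c.State} {L : List Tuple}
    (h : c.Yields M s T L) : c.size s ≤ M := by
  cases h <;> assumption

/-! ## Complete runs of binary operators -/

/-- The operator in the state `o`, reading the lists `La` and `Ld`, halts after exactly `N` steps,
emits the list `out`, and never uses more than `M` memory cells itself. -/
inductive BinOp.Runs (O : BinOp) (M : ℕ) :
    O.State → List Tuple → List Tuple → ℕ → List Tuple → Prop
  | halt {o La Ld} : O.size o ≤ M → O.step o La.head? Ld.head? = .halt → Runs O M o La Ld 1 []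
  | silent {o La Ld x y o' N out} : O.size o ≤ M →
      O.step o La.head? Ld.head? = .go x y none o' →
      Runs O M o' (if x then La.tail else La) (if y then Ld.tail else Ld) N out →
      Runs O M o La Ld (N + 1) out
  | emit {o La Ld x y t o' N out} : O.size o ≤ M →
      O.step o La.head? Ld.head? = .go x y (some t) o' →
      Runs O M o' (if x then La.tail else La) (if y then Ld.tail else Ld) N out →
      Runs O M o La Ld (N + 1) (t :: out)

/-- The input still provides the list `L`, for which the child needs `T` steps. -/
inductive Feed.Yields (c : Cursor) (M k : ℕ) : Feed c.State → ℕ → List Tuple → Prop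
  | need {s T L} : c.Yields M s T L → (∀ t ∈ L, t.length ≤ k) → Yields c M k (.need s) T L
  | item {t s T L} : c.Yields M s T L → (∀ u ∈ t :: L, u.length ≤ k) →
      Yields c M k (.item t s) T (t :: L)
  | eof : Yields c M k .eof 0 []

theorem Feed.Yields.size_le {c : Cursor} {M k T : ℕ} {f : Feed c.State} {L : List Tuple}
    (h : Feed.Yields c M k f T L) : f.size c.size ≤ M + k := by
  cases h with
  | need h _ => exact h.size_le.trans (by omega)
  | item h hk =>
    have := h.size_le
    have := hk _ List.mem_cons_self
    simp only [Feed.size]; omega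
  | eof => simp [Feed.size]

theorem Feed.Yields.pull {c : Cursor} {M k T : ℕ} {s : c.State} {L : List Tuple}
    (h : Feed.Yields c M k (.need s) T L) : ∃ T', T = T' + 1 ∧ Feed.Yields c M k (c.pull s) T' L := by
  cases h with
  | need h hk =>
    cases h with
    | done _ hst => exact ⟨0, rfl, by simpa [Cursor.pull, hst] using .eof⟩
    | silent _ hst h => exact ⟨_, rfl, by simpa [Cursor.pull, hst] using .need h hk⟩
    | emit _ hst h => exact ⟨_, rfl, by simpa [Cursor.pull, hst] using .item h hk⟩

theorem Feed.Yields.advance {c : Cursor} {M k T : ℕ} {f : Feed c.State} {L : List Tuple}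
    (h : Feed.Yields c M k f T L) (hf : ∀ s, f ≠ .need s) (b : Bool) :
    Feed.Yields c M k (if b then f.advance else f) T (if b then L.tail else L) := by
  cases b with
  | false => simpa using h
  | true =>
    cases h with
    | need _ _ => exact absurd rfl (hf _)
    | item h hk => exact .need h fun u hu => hk u (List.mem_cons_of_mem _ hu)
    | eof => exact .eof

theorem Feed.Yields.current {c : Cursor} {M k T : ℕ} {f : Feed c.State} {L : List Tuple}
    (h : Feed.Yields c M k f T L) (hf : ∀ s, f ≠ .need s) : f.current = L.head? := by
  cases h with
  | need _ _ => exact absurd rfl (hf _)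
  | item _ _ => rfl
  | eof => rfl

theorem Cursor.binary_step_op (O : BinOp) (A B : Cursor) (o : O.State) (fa : Feed A.State)
    (fd : Feed B.State) (ha : ∀ s, fa ≠ .need s) (hd : ∀ s, fd ≠ .need s) :
    (Cursor.binary O A B).step (o, fa, fd) =
      match O.step o fa.current fd.current with
      | .halt => .done
      | .go advA advD none o' =>
        .silent (o', if advA then fa.advance else fa, if advD then fd.advance else fd)
      | .go advA advD (some t) o' =>
        .emit t (o', if advA then fa.advance else fa, if advD then fd.advance else fd) := by
  cases fa <;> cases fd <;> simp_all [Cursor.binary] <;>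
    (generalize O.step o _ _ = r; rcases r with ⟨_, _, _ | _, _⟩ | _ <;> rfl)

theorem Cursor.binary_step_needD (O : BinOp) (A B : Cursor) (o : O.State) (fa : Feed A.State)
    (s : B.State) (ha : ∀ s, fa ≠ .need s) :
    (Cursor.binary O A B).step (o, fa, .need s) = .silent (o, fa, B.pull s) := by
  cases fa with
  | need s => exact absurd rfl (ha s)
  | item t s => rfl
  | eof => rfl

theorem Feed.need_or {S : Type} (f : Feed S) : (∃ s, f = .need s) ∨ ∀ s, f ≠ .need s := by
  cases f <;> simp

/-- Each step of the composite is a step of exactly one of the two children or of the operator, so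
the costs add up and the operator can be analysed on plain lists. The time is only bounded from
above because the operator may halt before its children have finished. -/
theorem Cursor.binary_yields (O : BinOp) (A B : Cursor) {Ma Mb Mo ka kb : ℕ} :
    ∀ (n : ℕ) {Ta Tb N : ℕ} {o : O.State} {fa : Feed A.State} {fd : Feed B.State}
      {La Ld out : List Tuple}, Ta + Tb + N ≤ n → Feed.Yields A Ma ka fa Ta La →
      Feed.Yields B Mb kb fd Tb Ld → O.Runs Mo o La Ld N out →
      ∃ T ≤ Ta + Tb + N,
        (Cursor.binary O A B).Yields (1 + Mo + (Ma + ka) + (Mb + kb)) (o, fa, fd) T out := by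
  intro n
  induction n with
  | zero => intro Ta Tb N o fa fd La Ld out hn _ _ h; cases h <;> omega
  | succ n ih =>
    intro Ta Tb N o fa fd La Ld out hn ha hd h
    have hsize : (Cursor.binary O A B).size (o, fa, fd) ≤ 1 + Mo + (Ma + ka) + (Mb + kb) := by
      have h1 := ha.size_le
      have h2 := hd.size_le
      have h3 : O.size o ≤ Mo := by cases h <;> assumption
      simp only [Cursor.binary]; omega
    rcases fa.need_or with ⟨s, rfl⟩ | hna
    · obtain ⟨T', rfl, ha'⟩ := ha.pull
      obtain ⟨T, hT, hY⟩ := ih (by omega) ha' hd h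
      exact ⟨T + 1, by omega, .silent hsize rfl hY⟩
    rcases fd.need_or with ⟨s, rfl⟩ | hnd
    · obtain ⟨T', rfl, hd'⟩ := hd.pull
      obtain ⟨T, hT, hY⟩ := ih (by omega) ha hd' h
      exact ⟨T + 1, by omega, .silent hsize (binary_step_needD O A B o fa s hna) hY⟩
    have hstep := binary_step_op O A B o fa fd hna hnd
    rw [ha.current hna, hd.current hnd] at hstep
    cases h with
    | halt _ hst =>
      rw [hst] at hstep
      exact ⟨1, by omega, .done hsize hstep⟩
    | silent _ hst h =>
      rw [hst] at hstep
      obtain ⟨T, hT, hY⟩ := ih (by omega) (ha.advance hna _) (hd.advance hnd _) h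
      exact ⟨T + 1, by omega, .silent hsize hstep hY⟩
    | emit _ hst h =>
      rw [hst] at hstep
      obtain ⟨T, hT, hY⟩ := ih (by omega) (ha.advance hna _) (hd.advance hnd _) h
      exact ⟨T + 1, by omega, .emit hsize hstep hY⟩

theorem Cursor.Delivers.binary {O : BinOp} {A B : Cursor} {Ta Tb Ma Mb Mo ka kb N : ℕ}
    {La Ld out : List Tuple} (hA : A.Delivers Ta Ma La) (hB : B.Delivers Tb Mb Ld)
    (hka : ∀ t ∈ La, t.length ≤ ka) (hkb : ∀ t ∈ Ld, t.length ≤ kb)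
    (h : O.Runs Mo O.init La Ld N out) :
    (Cursor.binary O A B).Delivers (Ta + Tb + N) (1 + Mo + (Ma + ka) + (Mb + kb)) out := by
  obtain ⟨Ta', hTa, hA⟩ := hA
  obtain ⟨Tb', hTb, hB⟩ := hB
  obtain ⟨T, hT, hY⟩ := Cursor.binary_yields O A B _ le_rfl (.need hA hka) (.need hB hkb) h
  exact ⟨T, by omega, hY⟩

/-! ## Stack-based joins of non-recursive inputs -/

/-- In column `i`, the tuple `a` ends before the tuple `b` starts. -/
def EndsBefore (i : ℕ) (a b : Tuple) : Prop := (a.col i).right < (b.col i).left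

/-- No push can happen on top of `e`: if the current item of the second input starts no later than
`e` ends, it starts before every remaining item of the first input and is probed; otherwise both
inputs are past `e`, which is popped. -/
theorem stackMove_some {i j : ℕ} {e : Tuple} {La : List Tuple}
    (h : ∀ a ∈ La, EndsBefore i e a) (Ld : List Tuple) :
    stackMove i j (some (e.col i)) La.head? Ld.head? = .pop ∨
      ∃ d Ld', Ld = d :: Ld' ∧
        stackMove i j (some (e.col i)) La.head? Ld.head? = .probe d := by
  rcases La with _ | ⟨a, La⟩
  · rcases Ld with _ | ⟨d, Ld⟩
    · left; rfl
    · by_cases hd : (e.col i).right < (d.col j).left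
      · left; simp [stackMove, startsAfter, hd]
      · right; exact ⟨d, Ld, rfl, by simp [stackMove, startsAfter, hd]⟩
  · have ha : (e.col i).right < (a.col i).left := h a List.mem_cons_self
    rcases Ld with _ | ⟨d, Ld⟩
    · left; simp [stackMove, startsAfter, ha]
    · by_cases hd : (e.col i).right < (d.col j).left
      · left; simp [stackMove, startsAfter, hd, ha]
      · right
        refine ⟨d, Ld, rfl, ?_⟩
        have : ¬ (a.col i).left < (d.col j).left := by omega
        simp [stackMove, startsAfter, hd, this]

/-- `O` joins the lists `La` and `Ld`, its state `o` holding the tuples `st` of the first input; every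
tuple of `Ld` is joined with at most one tuple. -/
def BinOp.JoinsOnce (O : BinOp) (M : ℕ) (out : Tuple → Tuple → Tuple) (o : O.State)
    (st La Ld : List Tuple) : Prop :=
  ∃ N ≤ st.length + 2 * La.length + 3 * Ld.length + 1, ∃ P : List (Tuple × Tuple),
    O.Runs M o La Ld N (P.map fun p => out p.1 p.2) ∧
    (P.map Prod.snd).Sublist Ld ∧ ∀ p ∈ P, p.1 ∈ st ++ La

/-- A stack-based operator whose states `σ st` stand for a stack with at most one entry joins every
tuple of the second input at most once, if the first input is not recursive. -/
theorem BinOp.joinsOnce_of_moves {O : BinOp} {i j k M : ℕ} {out : Tuple → Tuple → Tuple}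
    (σ : Option Tuple → O.State)
    (hsize : ∀ st, (∀ e ∈ st, e.length ≤ k) → O.size (σ st) ≤ M)
    (hhalt : O.step (σ none) none none = .halt)
    (hpush : ∀ a t d, stackMove i j none a d = .push t →
      O.step (σ none) a d = .go true false none (σ (some t)))
    (hpop : ∀ e a d, stackMove i j (some (e.col i)) a d = .pop →
      O.step (σ (some e)) a d = .go false false none (σ none))
    (hprobe : ∀ st La Ld d N L, (∀ e ∈ st, e.length ≤ k) →
      stackMove i j (st.map fun e => e.col i) La.head? (some d) = .probe d →
      O.Runs M (σ st) La Ld N L → ∃ N' ≤ N + 3, O.Runs M (σ st) La (d :: Ld) N' L ∨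
        ∃ e ∈ st, O.Runs M (σ st) La (d :: Ld) N' (out e d :: L)) (n : ℕ) :
    ∀ (st : Option Tuple) (La Ld : List Tuple),
      st.toList.length + 2 * La.length + 3 * Ld.length ≤ n →
      (st.toList ++ La).Pairwise (EndsBefore i) → (∀ t ∈ st.toList ++ La, t.length ≤ k) →
      O.JoinsOnce M out (σ st) st.toList La Ld := by
  -- The induction is on the remaining work. An unread tuple of the first input has weight 2 (push
  -- and pop), one on the stack weight 1 (pop), and an unread tuple of the second input weight 3
  -- (start of the probe, one comparison, end of the probe). The extra 1 in the bound is the halting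
  -- step.
  induction n with
  | zero =>
    intro st La Ld hn _ hk
    obtain ⟨rfl, rfl, rfl⟩ : st = none ∧ La = [] ∧ Ld = [] := by
      refine ⟨?_, ?_, ?_⟩
      · cases st <;> simp at hn ⊢
      · exact List.eq_nil_of_length_eq_zero (by omega)
      · exact List.eq_nil_of_length_eq_zero (by omega)
    exact ⟨1, by simp, [], .halt (hsize none (by simp)) hhalt, by simp, by simp⟩
  | succ n ih =>
    intro st La Ld hn hp hk
    have hst : ∀ e ∈ st, e.length ≤ k := fun e he => hk e (by simp_all)
    have probe : ∀ d Ld', Ld = d :: Ld' →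
        stackMove i j (st.map fun e => e.col i) La.head? Ld.head? = .probe d →
        O.JoinsOnce M out (σ st) st.toList La Ld := by
      rintro d Ld' rfl hm
      simp only [List.length_cons] at hn
      obtain ⟨N, hN, P, hR, hs, hmem⟩ := ih st La Ld' (by omega) hp hk
      obtain ⟨N', hN', h | ⟨e, he, h⟩⟩ := hprobe st La Ld' d N _ hst hm hR
      · exact ⟨N', by simp at hN ⊢; omega, P, h, hs.cons _, hmem⟩
      · refine ⟨N', by simp at hN ⊢; omega, (e, d) :: P, h, hs.cons_cons _, ?_⟩
        intro p hp
        rcases List.mem_cons.1 hp with rfl | hp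
        · simp_all
        · exact hmem p hp
    rcases st with _ | e
    · have push : ∀ a La', La = a :: La' →
          stackMove i j none La.head? Ld.head? = .push a → O.JoinsOnce M out (σ none) [] La Ld := by
        rintro a La' rfl hm
        obtain ⟨N, hN, P, hR, hs, hmem⟩ := ih (some a) La' Ld
          (by simp at hn ⊢; omega) (by simpa using hp) (by simpa using hk)
        exact ⟨N + 1, by simp at hN ⊢; omega, P,
          .silent (x := true) (y := false) (hsize none hst) (hpush _ _ _ hm) hR, hs,
          by simpa using hmem⟩
      rcases La with _ | ⟨a, La⟩
      · rcases Ld with _ | ⟨d, Ld⟩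
        · exact ⟨1, by simp, [], .halt (hsize none hst) hhalt, by simp, by simp⟩
        · exact probe d Ld rfl rfl
      · rcases Ld with _ | ⟨d, Ld⟩
        · exact push a La rfl rfl
        · by_cases hlt : (a.col i).left < (d.col j).left
          · exact push a La rfl (by simp [stackMove, hlt])
          · exact probe d Ld rfl (by simp [stackMove, hlt])
    · simp only [Option.toList_some, List.singleton_append, List.pairwise_cons] at hp
      rcases stackMove_some (j := j) hp.1 Ld with hm | ⟨d, Ld', rfl, hm⟩
      · obtain ⟨N, hN, P, hR, hs, hmem⟩ := ih none La Ld
          (by simp at hn ⊢; omega) (by simpa using hp.2) (fun t ht => hk t (by simp_all))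
        exact ⟨N + 1, by simp at hN ⊢; omega, P,
          .silent (x := false) (y := false) (hsize _ hst) (hpop _ _ _ hm) hR, hs,
          fun p hp => List.mem_append_right _ (hmem p hp)⟩
      · exact probe d Ld' rfl hm

/-- The only stack entry sits at position 0, where joined tuples are emitted directly; all lists
stay empty, and the memory is one tuple plus the pointer. As `test` is arbitrary, the variant with a
secondary relationship is covered too. -/
theorem stackTreeAnc_joinsOnce {i j k : ℕ} {test : Tuple → Tuple → Bool}
    {out : Tuple → Tuple → Tuple} {La : List Tuple} (Ld : List Tuple)
    (hp : La.Pairwise (EndsBefore i)) (hk : ∀ t ∈ La, t.length ≤ k) :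
    (stackTreeAnc i j test out).JoinsOnce (k + 1) out (stackTreeAnc i j test out).init [] La Ld := by
  have hsize : ∀ (st : Option Tuple) (p : Option ℕ), (∀ e ∈ st, e.length ≤ k) →
      (stackTreeAnc i j test out).size ⟨st.toList.map fun t => ⟨t, [], []⟩, p, []⟩ ≤ k + 1 := by
    intro st p h
    rcases st with _ | e
    · simp [stackTreeAnc, storage]
    · simpa [stackTreeAnc, storage] using h e rfl
  refine BinOp.joinsOnce_of_moves (O := stackTreeAnc i j test out) (i := i) (j := j) (k := k)
    (fun st => ⟨st.toList.map fun t => ⟨t, [], []⟩, none, []⟩) (fun st => hsize st none) rfl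
    ?_ ?_ ?_ _ none La Ld le_rfl hp hk
  · intro a t d h
    simp [stackTreeAnc, h]
  · intro e a d h
    simp [stackTreeAnc, h]
  · intro st La Ld d N L hst hm hR
    have hm1 : (stackTreeAnc i j test out).step ⟨st.toList.map fun t => ⟨t, [], []⟩, none, []⟩
        La.head? (d :: Ld).head? =
        .go false false none ⟨st.toList.map fun t => ⟨t, [], []⟩, some 0, []⟩ := by
      cases st <;> simp_all [stackTreeAnc]
    rcases st with _ | e
    · exact ⟨N + 1 + 1, by omega, .inl (.silent (hsize none none hst) hm1
        (.silent (hsize none (some 0) hst) rfl hR))⟩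
    -- Position 1 lies beyond the single entry, so this step ends the probe and advances the second
    -- input.
    · have hend := BinOp.Runs.silent (x := false) (y := true) (La := La) (Ld := d :: Ld)
        (hsize (some e) (some 1) hst) rfl hR
      by_cases ht : test e d = true
      · exact ⟨N + 1 + 1 + 1, by omega, .inr ⟨e, rfl, .silent (hsize (some e) none hst) hm1
          (.emit (x := false) (y := false) (hsize (some e) (some 0) hst)
            (by simp [stackTreeAnc, ht]) hend)⟩⟩
      · exact ⟨N + 1 + 1 + 1, by omega, .inl (.silent (hsize (some e) none hst) hm1
          (.silent (x := false) (y := false) (hsize (some e) (some 0) hst)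
            (by simp [stackTreeAnc, ht]) hend))⟩

theorem stackTreeDesc_joinsOnce {i j k : ℕ} {test : Tuple → Tuple → Bool}
    {out : Tuple → Tuple → Tuple} {La : List Tuple} (Ld : List Tuple)
    (hp : La.Pairwise (EndsBefore i)) (hk : ∀ t ∈ La, t.length ≤ k) :
    (stackTreeDesc i j test out).JoinsOnce (k + 1) out (stackTreeDesc i j test out).init
      [] La Ld := by
  have hsize : ∀ (st : Option Tuple) (p : Option ℕ), (∀ e ∈ st, e.length ≤ k) →
      (stackTreeDesc i j test out).size ⟨st.toList, p⟩ ≤ k + 1 := by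
    intro st p h
    rcases st with _ | e
    · simp [stackTreeDesc, storage]
    · simpa [stackTreeDesc, storage] using h e rfl
  refine BinOp.joinsOnce_of_moves (O := stackTreeDesc i j test out) (i := i) (j := j) (k := k)
    (fun st => ⟨st.toList, none⟩) (fun st => hsize st none) rfl
    ?_ ?_ ?_ _ none La Ld le_rfl hp hk
  · intro a t d h
    simp [stackTreeDesc, h]
  · intro e a d h
    simp [stackTreeDesc, h]
  · intro st La Ld d N L hst hm hR
    have hm1 : (stackTreeDesc i j test out).step ⟨st.toList, none⟩
        La.head? (d :: Ld).head? = .go false false none ⟨st.toList, some 0⟩ := by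
      cases st <;> simp_all [stackTreeDesc]
    rcases st with _ | e
    · exact ⟨N + 1 + 1, by omega, .inl (.silent (hsize none none hst) hm1
        (.silent (hsize none (some 0) hst) rfl hR))⟩
    · have hend := BinOp.Runs.silent (x := false) (y := true) (La := La) (Ld := d :: Ld)
        (hsize (some e) (some 1) hst) rfl hR
      by_cases ht : test e d = true
      · exact ⟨N + 1 + 1 + 1, by omega, .inr ⟨e, rfl, .silent (hsize (some e) none hst) hm1
          (.emit (x := false) (y := false) (hsize (some e) (some 0) hst)
            (by simp [stackTreeDesc, ht]) hend)⟩⟩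
      · exact ⟨N + 1 + 1 + 1, by omega, .inl (.silent (hsize (some e) none hst) hm1
          (.silent (x := false) (y := false) (hsize (some e) (some 0) hst)
            (by simp [stackTreeDesc, ht]) hend))⟩

/-- A join in which every tuple of the second input is joined with at most one tuple is linear. -/
theorem Cursor.Delivers.join {O : BinOp} {A B : Cursor} {Ta Tb Ma Mb ka kb : ℕ}
    {La Ld : List Tuple} {out : Tuple → Tuple → Tuple}
    (hA : A.Delivers Ta Ma La) (hB : B.Delivers Tb Mb Ld)
    (hka : ∀ t ∈ La, t.length ≤ ka) (hkb : ∀ t ∈ Ld, t.length ≤ kb)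
    (h : O.JoinsOnce (ka + 1) out O.init [] La Ld) :
    ∃ P : List (Tuple × Tuple),
      (Cursor.binary O A B).Delivers (Ta + Tb + (2 * La.length + 3 * Ld.length + 1))
        (Ma + Mb + (2 * ka + kb + 2)) (P.map fun p => out p.1 p.2) ∧
      (P.map Prod.snd).Sublist Ld ∧ ∀ p ∈ P, p.1 ∈ La := by
  obtain ⟨N, hN, P, hR, hs, hP⟩ := h
  refine ⟨P, (hA.binary hB hka hkb hR).mono ?_ ?_, hs, hP⟩
  · simp at hN; omega
  · omega

/-! ## The tuples delivered by semi-joins -/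

/-- The tuples emitted in the first `n` steps after the state `s`. -/
def Cursor.emits (c : Cursor) : ℕ → c.State → List Tuple
  | 0, _ => []
  | n + 1, s =>
    match c.step s with
    | .silent s' => c.emits n s'
    | .emit t s' => t :: c.emits n s'
    | .done => []

theorem Cursor.emits_succ (c : Cursor) (n : ℕ) (s : c.State) : c.emits (n + 1) s =
    match c.step s with
    | .silent s' => c.emits n s'
    | .emit t s' => t :: c.emits n s'
    | .done => [] := rfl

theorem Cursor.Yields.emits_eq {c : Cursor} {M T : ℕ} {s : c.State} {L : List Tuple}
    (h : c.Yields M s T L) : c.emits T s = L := by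
  induction h with
  | done _ hst => simp [emits, hst]
  | silent _ hst _ ih => simp [emits, hst, ih]
  | emit _ hst _ ih => simp [emits, hst, ih]

/-- The tuples an input provides while its child runs for `m` steps. -/
def Feed.emits (c : Cursor) (m : ℕ) : Feed c.State → List Tuple
  | .need s => c.emits m s
  | .item t s => t :: c.emits m s
  | .eof => []

theorem Cursor.emits_pull (c : Cursor) (m : ℕ) (s : c.State) :
    Feed.emits c m (c.pull s) = c.emits (m + 1) s := by
  unfold Cursor.pull Cursor.emits
  rcases c.step s with s' | ⟨t, s'⟩ | _ <;> rfl

theorem Feed.emits_current {c : Cursor} {f : Feed c.State} {t : Tuple} (m : ℕ)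
    (h : f.current = some t) : f.emits c m = t :: f.advance.emits c m := by
  cases f with
  | item u s => cases h; rfl
  | need s => cases h
  | eof => cases h

theorem Feed.emits_advance (c : Cursor) (f : Feed c.State) (m : ℕ) (b : Bool) :
    ((if b then f.advance else f).emits c m).Sublist (f.emits c m) := by
  cases b with
  | false => simp
  | true => cases f <;> simp [Feed.advance, Feed.emits]

theorem Cursor.emits_binary_needD (O : BinOp) (A B : Cursor) (n : ℕ) (o : O.State)
    (fa : Feed A.State) (s : B.State) (ha : ∀ s, fa ≠ .need s) :
    (Cursor.binary O A B).emits (n + 1) (o, fa, .need s) =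
      (Cursor.binary O A B).emits n (o, fa, B.pull s) := by
  refine (Cursor.emits_succ _ n _).trans ?_
  rw [binary_step_needD O A B o fa s ha]

theorem Cursor.emits_binary_op (O : BinOp) (A B : Cursor) (n : ℕ) (o : O.State) (fa : Feed A.State)
    (fd : Feed B.State) (ha : ∀ s, fa ≠ .need s) (hd : ∀ s, fd ≠ .need s) :
    (Cursor.binary O A B).emits (n + 1) (o, fa, fd) =
      match O.step o fa.current fd.current with
      | .halt => []
      | .go advA advD out o' => out.toList ++ (Cursor.binary O A B).emits n
          (o', if advA then fa.advance else fa, if advD then fd.advance else fd) := by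
  refine (Cursor.emits_succ _ n _).trans ?_
  rw [binary_step_op O A B o fa fd ha hd]
  generalize O.step o _ _ = r
  rcases r with ⟨_, _, _ | _, _⟩ | _ <;> rfl

/-- The operator only emits current items of the first input, advancing that input. -/
def BinOp.FiltersFst (O : BinOp) : Prop :=
  ∀ o a d advA advD t o', O.step o a d = .go advA advD (some t) o' → a = some t ∧ advA = true

/-- The operator only emits current items of the second input, advancing that input. -/
def BinOp.FiltersSnd (O : BinOp) : Prop :=
  ∀ o a d advA advD t o', O.step o a d = .go advA advD (some t) o' → d = some t ∧ advD = true

/-- Finite prefixes of runs are compared because termination is known for the whole constraining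
plan only, not for its subplans. How far the child has run after `n` steps depends on the
scheduling, hence the existential `m`. -/
theorem BinOp.FiltersFst.emits {O : BinOp} (hO : O.FiltersFst) (A B : Cursor) (n : ℕ) :
    ∀ o fa fd, ∃ m, ((Cursor.binary O A B).emits n (o, fa, fd)).Sublist (Feed.emits A m fa) := by
  induction n with
  | zero => exact fun o fa fd => ⟨0, by simp [Cursor.emits]⟩
  | succ n ih =>
    intro o fa fd
    rcases fa.need_or with ⟨s, rfl⟩ | hna
    · obtain ⟨m, hm⟩ := ih o (A.pull s) fd
      exact ⟨m + 1, by rwa [A.emits_pull] at hm⟩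
    rcases fd.need_or with ⟨s, rfl⟩ | hnd
    · obtain ⟨m, hm⟩ := ih o fa (B.pull s)
      exact ⟨m, by rwa [Cursor.emits_binary_needD _ _ _ _ _ _ _ hna]⟩
    rw [Cursor.emits_binary_op _ _ _ _ _ _ _ hna hnd]
    rcases h : O.step o fa.current fd.current with ⟨x, y, _ | t, o'⟩ | _
    · obtain ⟨m, hm⟩ := ih o' (if x then fa.advance else fa) (if y then fd.advance else fd)
      exact ⟨m, hm.trans (fa.emits_advance A m x)⟩
    · obtain ⟨hc, rfl⟩ := hO _ _ _ _ _ _ _ h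
      obtain ⟨m, hm⟩ := ih o' fa.advance (if y then fd.advance else fd)
      exact ⟨m, by simpa [Feed.emits_current m hc] using hm⟩
    · exact ⟨0, by simp⟩

theorem BinOp.FiltersSnd.emits {O : BinOp} (hO : O.FiltersSnd) (A B : Cursor) (n : ℕ) :
    ∀ o fa fd, ∃ m, ((Cursor.binary O A B).emits n (o, fa, fd)).Sublist (Feed.emits B m fd) := by
  induction n with
  | zero => exact fun o fa fd => ⟨0, by simp [Cursor.emits]⟩
  | succ n ih =>
    intro o fa fd
    rcases fa.need_or with ⟨s, rfl⟩ | hna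
    · exact ih o (A.pull s) fd
    rcases fd.need_or with ⟨s, rfl⟩ | hnd
    · obtain ⟨m, hm⟩ := ih o fa (B.pull s)
      rw [Cursor.emits_binary_needD _ _ _ _ _ _ _ hna]
      exact ⟨m + 1, by rwa [B.emits_pull] at hm⟩
    rw [Cursor.emits_binary_op _ _ _ _ _ _ _ hna hnd]
    rcases h : O.step o fa.current fd.current with ⟨x, y, _ | t, o'⟩ | _
    · obtain ⟨m, hm⟩ := ih o' (if x then fa.advance else fa) (if y then fd.advance else fd)
      exact ⟨m, hm.trans (fd.emits_advance B m y)⟩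
    · obtain ⟨hc, rfl⟩ := hO _ _ _ _ _ _ _ h
      obtain ⟨m, hm⟩ := ih o' (if x then fa.advance else fa) fd.advance
      exact ⟨m, by simpa [Feed.emits_current m hc] using hm⟩
    · exact ⟨0, by simp⟩

-- The four semi-joins as filters.

theorem semiDescAD_filtersSnd : semiDescAD.FiltersSnd := by
  rintro o (_ | a) (_ | d) advA advD t o' h <;> simp only [semiDescAD] at h <;> try cases h
  split_ifs at h <;> cases h
  exact ⟨rfl, rfl⟩

theorem semiAncAD_filtersFst : semiAncAD.FiltersFst := by
  rintro o (_ | a) (_ | d) advA advD t o' h <;> simp only [semiAncAD] at h <;> try cases h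
  split_ifs at h <;> cases h
  exact ⟨rfl, rfl⟩

theorem stackMove_probe {i j : ℕ} {top : Option Label} {a d : Option Tuple} {t : Tuple}
    (h : stackMove i j top a d = .probe t) : d = some t := by
  unfold stackMove at h
  split_ifs at h
  rcases a with _ | a <;> rcases d with _ | d <;> simp at h
  · rw [h]
  · split_ifs at h; cases h; rfl

theorem stackMove_push {i j : ℕ} {top : Option Label} {a d : Option Tuple} {t : Tuple}
    (h : stackMove i j top a d = .push t) : a = some t := by
  unfold stackMove at h
  split_ifs at h
  rcases a with _ | a <;> rcases d with _ | d <;> simp at h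
  · rw [h]
  · split_ifs at h; cases h; rfl

theorem semiDescPC_filtersSnd : semiDescPC.FiltersSnd := by
  intro o a d advA advD t o' h
  simp only [semiDescPC] at h
  split at h
  · cases h
  · cases h
  · cases h
  · rename_i u hu
    injection h with _ hd h _
    split_ifs at h
    cases h
    exact ⟨stackMove_probe hu, hd.symm⟩

/-- The state of the ancestor-filtering semi-join for PC with at most one stack entry. -/
def semiAncPCState (st : Option (Tuple × Bool)) : semiAncPC.State :=
  (⟨st.toList.map fun p => ⟨p.1, p.2, []⟩, []⟩ : SemiAncState)

theorem not_push_of_endsBefore {i j : ℕ} {e a : Tuple} {d : Option Tuple} (h : EndsBefore i e a)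
    (t : Tuple) : stackMove i j (some (e.col i)) (some a) d ≠ .push t := by
  intro hm
  have h' : (e.col i).right < (a.col i).left := h
  unfold stackMove at hm
  rcases d with _ | d
  · simp [startsAfter, h'] at hm
  · by_cases hd : (e.col i).right < (d.col j).left
    · simp [startsAfter, h', hd] at hm
    · have : ¬ (a.col i).left < (d.col j).left := by omega
      simp [startsAfter, h', hd, this] at hm

/-- The tuple waiting to be hit. -/
def unhit : Option (Tuple × Bool) → List Tuple
  | some (e, false) => [e]
  | _ => []

/-- This operator emits from its stack, after the input has moved on, so it is not of type
`FiltersFst`. With disjoint labels the stack has at most one entry. That entry is emitted at its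
first hit, before anything later is pushed, and the flag prevents a second emission; `unhit`
accounts for it until then. -/
theorem semiAncPC_emits (A B : Cursor) (n : ℕ) :
    ∀ (st : Option (Tuple × Bool)) fa fd,
      (∀ m, (st.toList.map Prod.fst ++ Feed.emits A m fa).Pairwise (EndsBefore 0)) →
      ∃ m, ((Cursor.binary semiAncPC A B).emits n (semiAncPCState st, fa, fd)).Sublist
        (unhit st ++ Feed.emits A m fa) := by
  induction n with
  | zero => exact fun o fa fd _ => ⟨0, by simp [Cursor.emits]⟩
  | succ n ih =>
    intro st fa fd hp
    rcases fa.need_or with ⟨s, rfl⟩ | hna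
    · obtain ⟨m, hm⟩ := ih st (A.pull s) fd fun m => by
        rw [A.emits_pull]; exact hp (m + 1)
      exact ⟨m + 1, by rwa [A.emits_pull] at hm⟩
    rcases fd.need_or with ⟨s, rfl⟩ | hnd
    · obtain ⟨m, hm⟩ := ih st fa (B.pull s) hp
      exact ⟨m, by rwa [Cursor.emits_binary_needD _ _ _ _ _ _ _ hna]⟩
    rw [Cursor.emits_binary_op _ _ _ _ _ _ _ hna hnd]
    rcases hmv : stackMove 0 0 (st.map fun p => p.1.col 0) fa.current fd.current with
      _ | t | t | _
    · have hstep : semiAncPC.step (semiAncPCState st) fa.current fd.current =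
          .go false false none (semiAncPCState none) := by
        rcases st with _ | ⟨e, b⟩ <;> simp_all [semiAncPC, semiAncPCState]
      rw [hstep]
      obtain ⟨m, hm⟩ := ih none fa fd fun m => ((hp m).sublist (List.sublist_append_right _ _))
      exact ⟨m, hm.trans (by simp [unhit])⟩
    · have hc := stackMove_push hmv
      rcases st with _ | ⟨e, b⟩
      · have hstep : semiAncPC.step (semiAncPCState none) fa.current fd.current =
            .go true false none (semiAncPCState (some (t, false))) := by
          simp_all [semiAncPC, semiAncPCState]
        rw [hstep]
        obtain ⟨m, hm⟩ := ih (some (t, false)) fa.advance fd fun m => by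
          simpa [Feed.emits_current m hc] using hp m
        exact ⟨m, by simpa [Feed.emits_current m hc, unhit] using hm⟩
      · have := hp 0
        rw [Feed.emits_current 0 hc] at this
        simp only [Option.toList_some, List.map_cons, List.map_nil, List.singleton_append,
          List.pairwise_cons] at this
        rw [hc] at hmv
        exact absurd hmv (not_push_of_endsBefore (this.1 t List.mem_cons_self) t)
    · rcases st with _ | ⟨e, b⟩
      · have hstep : semiAncPC.step (semiAncPCState none) fa.current fd.current =
            .go false true none (semiAncPCState none) := by
          simp_all [semiAncPC, semiAncPCState]
        rw [hstep]
        obtain ⟨m, hm⟩ := ih none fa fd.advance hp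
        exact ⟨m, hm⟩
      · by_cases hr : Rel.PC.Holds (e.col 0) (t.col 0)
        · have hstep : semiAncPC.step (semiAncPCState (some (e, b))) fa.current fd.current =
              .go false true (if b then none else some e) (semiAncPCState (some (e, true))) := by
            cases b <;> simp_all [semiAncPC, semiAncPCState]
          rw [hstep]
          obtain ⟨m, hm⟩ := ih (some (e, true)) fa fd.advance hp
          refine ⟨m, ?_⟩
          cases b <;> simpa [unhit] using hm
        · have hstep : semiAncPC.step (semiAncPCState (some (e, b))) fa.current fd.current =
              .go false true none (semiAncPCState (some (e, b))) := by
            simp_all [semiAncPC, semiAncPCState]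
          rw [hstep]
          obtain ⟨m, hm⟩ := ih (some (e, b)) fa fd.advance hp
          exact ⟨m, hm⟩
    · have hstep : semiAncPC.step (semiAncPCState st) fa.current fd.current = .halt := by
        rcases st with _ | ⟨e, b⟩ <;> simp_all [semiAncPC, semiAncPCState]
      rw [hstep]
      exact ⟨0, by simp⟩

/-! ## Plans of constraining subqueries -/

section
variable {Tag : Type*} [DecidableEq Tag]

/-- The plan delivers, in the given order and at most once, elements of the list `T`. -/
def Plan.Filters (D : XTree Tag) (T : List Label) (P : Plan Tag) : Prop :=
  ∀ n, ((P.exec D).emits n (P.exec D).init).Sublist (T.map fun x => [x])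

theorem Plan.filters_scan (D : XTree Tag) (t : Tag) : Plan.Filters D (D.stream t) (.scan t) := by
  have h : ∀ n (l : List Label), ((Cursor.scan (D.stream t)).emits n l).Sublist
      (l.map fun x => [x]) := by
    intro n
    induction n with
    | zero => simp [Cursor.emits]
    | succ n ih =>
      intro l
      cases l with
      | nil => simp [Cursor.emits, Cursor.scan]
      | cons x l => exact (ih l).cons_cons _
  intro n
  rw [Plan.exec]
  exact h n _

theorem Plan.Filters.semiDesc {D : XTree Tag} {T : List Label} {P : Plan Tag}
    (h : P.Filters D T) (α : Rel) (Pu : Plan Tag) : (Plan.semiDesc α Pu P).Filters D T := by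
  intro n
  cases α
  · rw [Plan.exec]
    obtain ⟨m, hm⟩ := semiDescAD_filtersSnd.emits (Pu.exec D) (P.exec D) n ()
      (.need (Pu.exec D).init) (.need (P.exec D).init)
    exact hm.trans (h m)
  · rw [Plan.exec]
    obtain ⟨m, hm⟩ := semiDescPC_filtersSnd.emits (Pu.exec D) (P.exec D) n []
      (.need (Pu.exec D).init) (.need (P.exec D).init)
    exact hm.trans (h m)

theorem pairwise_endsBefore_singletons {T : List Label}
    (hT : T.Pairwise fun a b => a.right < b.left) :
    (T.map fun x => [x]).Pairwise (EndsBefore 0) := by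
  rw [List.pairwise_map]
  exact hT.imp fun h => by simpa [EndsBefore, Tuple.col] using h

/-- Disjointness enters only for PC, where hit entries above the bottom would be delayed; the AD
semi-join emits current items only. -/
theorem Plan.Filters.semiAnc {D : XTree Tag} {T : List Label} {P : Plan Tag}
    (h : P.Filters D T) (hT : T.Pairwise fun a b => a.right < b.left) (α : Rel) (Pu : Plan Tag) :
    (Plan.semiAnc α P Pu).Filters D T := by
  intro n
  cases α
  · rw [Plan.exec]
    obtain ⟨m, hm⟩ := semiAncAD_filtersFst.emits (P.exec D) (Pu.exec D) n ()
      (.need (P.exec D).init) (.need (Pu.exec D).init)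
    exact hm.trans (h m)
  · rw [Plan.exec]
    obtain ⟨m, hm⟩ := semiAncPC_emits (P.exec D) (Pu.exec D) n none
      (.need (P.exec D).init) (.need (Pu.exec D).init)
      fun m => (pairwise_endsBefore_singletons hT).sublist (h m)
    exact hm.trans (h m)

/-- The recursively built plans occur only as filters, so nothing has to be known about them, and a
fold over the neighbors suffices without recursion on the fuel. -/
theorem Query.buildCons_filters (ord : NeighborOrder) (Q : Query Tag) (D : XTree Tag) (v : ℕ)
    (hT : (D.stream (Q.tag v)).Pairwise fun a b => a.right < b.left) (f : ℕ) (S : Finset ℕ) :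
    (Q.buildCons ord f S v).Filters D (D.stream (Q.tag v)) := by
  cases f with
  | zero => exact Plan.filters_scan D _
  | succ f =>
    rw [Query.buildCons]
    refine List.foldlRecOn (motive := fun P : Plan Tag => P.Filters D (D.stream (Q.tag v))) _ _
      (Plan.filters_scan D _) fun P hP u _ => ?_
    split_ifs
    · exact hP.semiDesc _ _
    · exact hP.semiAnc hT _ _

end

/-! ## Labels of a document -/

/-- The label `a` contains or precedes the label `b`. -/
def Label.ContainsOrPrecedes (a b : Label) : Prop := a.IsAncestor b ∨ a.right < b.left

mutual
theorem XTree.labelFrom_bounds {Tag : Type*} (t : XTree Tag) (l lev : ℕ) :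
    ∀ x ∈ t.labelFrom l lev, l ≤ x.2.left ∧ x.2.right < l + 2 * t.size := by
  cases t with
  | node tag cs =>
    intro x hx
    rw [XTree.labelFrom, List.mem_cons] at hx
    rw [XTree.size]
    rcases hx with rfl | hx
    · exact ⟨le_rfl, by dsimp only; omega⟩
    · have := XTree.labelListFrom_bounds cs (l + 1) (lev + 1) x hx
      omega
theorem XTree.labelListFrom_bounds {Tag : Type*} (ts : List (XTree Tag)) (l lev : ℕ) :
    ∀ x ∈ XTree.labelListFrom ts l lev,
      l ≤ x.2.left ∧ x.2.right < l + 2 * XTree.sizeList ts := by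
  cases ts with
  | nil => intro x hx; simp [XTree.labelListFrom] at hx
  | cons t ts =>
    intro x hx
    rw [XTree.labelListFrom, List.mem_append] at hx
    rw [XTree.sizeList]
    rcases hx with hx | hx
    · have := XTree.labelFrom_bounds t l lev x hx
      omega
    · have := XTree.labelListFrom_bounds ts (l + 2 * t.size) lev x hx
      omega
end

mutual
theorem XTree.labelFrom_pairwise {Tag : Type*} (t : XTree Tag) (l lev : ℕ) :
    (t.labelFrom l lev).Pairwise fun x y => x.2.ContainsOrPrecedes y.2 := by
  cases t with
  | node tag cs =>
    rw [XTree.labelFrom, List.pairwise_cons]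
    refine ⟨fun x hx => .inl ?_, XTree.labelListFrom_pairwise cs (l + 1) (lev + 1)⟩
    have := XTree.labelListFrom_bounds cs (l + 1) (lev + 1) x hx
    constructor <;> dsimp only <;> omega
theorem XTree.labelListFrom_pairwise {Tag : Type*} (ts : List (XTree Tag)) (l lev : ℕ) :
    (XTree.labelListFrom ts l lev).Pairwise fun x y => x.2.ContainsOrPrecedes y.2 := by
  cases ts with
  | nil => simp [XTree.labelListFrom]
  | cons t ts =>
    rw [XTree.labelListFrom, List.pairwise_append]
    refine ⟨XTree.labelFrom_pairwise t l lev, XTree.labelListFrom_pairwise ts _ lev,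
      fun x hx y hy => .inr ?_⟩
    have h1 := XTree.labelFrom_bounds t l lev x hx
    have h2 := XTree.labelListFrom_bounds ts _ lev y hy
    omega
end

theorem XTree.one_le_depth {Tag : Type*} (D : XTree Tag) : 1 ≤ D.depth := by
  cases D with
  | node t cs => simp [XTree.depth, XTree.dataNodes, XTree.labelFrom]

/-- In document order an earlier node either contains a later one or ends before it starts;
non-recursiveness excludes containment. -/
theorem XTree.stream_pairwise {Tag : Type*} [DecidableEq Tag] (D : XTree Tag) (t : Tag)
    (h : ¬ IsRecursive (D.stream t)) : (D.stream t).Pairwise fun a b => a.right < b.left := by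
  have hp : (D.stream t).Pairwise Label.ContainsOrPrecedes := by
    rw [XTree.stream, List.pairwise_map]
    exact (XTree.labelFrom_pairwise D 1 1).filter _
  refine hp.imp_of_mem fun {a b} ha hb hab => hab.resolve_left fun hanc => h ⟨a, ha, b, hb, hanc⟩

/-! ## Constraining subqueries -/

namespace Query

variable {Tag : Type*}

theorem IsTPQ.parent_lt {Q : Query Tag} (hQ : Q.IsTPQ) {v p : ℕ} (hv : v ∈ Q.nodes)
    (hp : p ∈ Q.nodes) (h : Q.parent v = some p) : p < v := by
  obtain ⟨r, _, hr, htree⟩ := hQ.tree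
  have hvr : v ≠ r := by rintro rfl; exact hr p hp h
  obtain ⟨p', _, hlt, hp'⟩ := htree v hv hvr
  rw [h] at hp'
  cases hp'
  exact hlt

theorem graph_adj (Q : Query Tag) {u v : ℕ} : Q.graph.Adj u v ↔
    u ∈ Q.nodes ∧ v ∈ Q.nodes ∧ u ≠ v ∧ (Q.parent v = some u ∨ Q.parent u = some v) := Iff.rfl

/-- Every edge of a twig pattern query separates the subtree below it from its upper end. -/
theorem IsTPQ.not_reachable_parent {Q : Query Tag} (hQ : Q.IsTPQ) {u v : ℕ} (hu : u ∈ Q.nodes)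
    (hv : v ∈ Q.nodes) (h : Q.parent v = some u) :
    ¬ (Q.graph.deleteEdges {s(v, u)}).Reachable v u := by
  let R : ℕ → ℕ → Prop := fun a b => a ∈ Q.nodes ∧ b ∈ Q.nodes ∧ Q.parent a = some b
  -- Without the edge to `u`, no edge leaves the set of descendants of `v`. Those are numbered at
  -- least `v`, whereas the parent `u` has a smaller number.
  have hstep : ∀ x y, (Q.graph.deleteEdges {s(v, u)}).Adj x y → Relation.ReflTransGen R x v →
      Relation.ReflTransGen R y v := by
    intro x y hxy hx
    rw [SimpleGraph.deleteEdges_adj, graph_adj] at hxy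
    obtain ⟨⟨hxn, hyn, _, hpar | hpar⟩, hne⟩ := hxy
    · exact .head ⟨hyn, hxn, hpar⟩ hx
    · rcases Relation.ReflTransGen.cases_head hx with rfl | ⟨z, ⟨_, _, hz⟩, hzv⟩
      · rw [h] at hpar
        cases hpar
        simp at hne
      · rw [hpar] at hz
        cases hz
        exact hzv
  have hle : ∀ x, Relation.ReflTransGen R x v → v ≤ x := by
    intro x hx
    induction hx using Relation.ReflTransGen.head_induction_on with
    | refl => exact le_rfl
    | head hab _ ih => exact ih.trans (hQ.parent_lt hab.1 hab.2.1 hab.2.2).le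
  rintro ⟨w⟩
  have hwalk : ∀ {x y : ℕ}, (Q.graph.deleteEdges {s(v, u)}).Walk x y →
      Relation.ReflTransGen R x v → Relation.ReflTransGen R y v := by
    intro x y w
    induction w with
    | nil => exact id
    | cons hxy _ ih => exact fun hx => ih (hstep _ _ hxy hx)
  have := hle u (hwalk w .refl)
  have := hQ.parent_lt hv hu h
  omega

theorem IsTPQ.isAcyclic {Q : Query Tag} (hQ : Q.IsTPQ) : Q.graph.IsAcyclic := by
  rw [SimpleGraph.isAcyclic_iff_forall_adj_isBridge]
  intro v u hvu
  rw [SimpleGraph.isBridge_iff]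
  rw [graph_adj] at hvu
  obtain ⟨hv, hu, _, h | h⟩ := hvu
  · rw [Sym2.eq_swap]
    exact fun hr => hQ.not_reachable_parent hv hu h hr.symm
  · exact hQ.not_reachable_parent hu hv h

theorem exists_walk_coreEdges {Q : Query Tag} {q : ℕ} (hq : q ∈ Q.coreNodes) :
    ∃ o ∈ Q.outputs, ∃ w : Q.graph.Walk o q, ∀ e ∈ w.edges, e ∈ Q.coreEdges := by
  classical
  simp only [coreNodes, Finset.mem_filter] at hq
  rcases hq.2 with ho | ⟨o₁, h₁, o₂, h₂, p, hp, hqp⟩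
  · exact ⟨q, ho, .nil, by simp⟩
  · exact ⟨o₁, h₁, p.takeUntil q hqp, fun e he =>
      ⟨o₁, h₁, o₂, h₂, p, hp, p.edges_takeUntil_subset_edges hqp he⟩⟩

/-- An edge at a core node that is not a core edge leads to a part of the query without output query
nodes. -/
theorem IsTPQ.not_mem_outputs {Q : Query Tag} (hQ : Q.IsTPQ) {q v : ℕ} (hq : q ∈ Q.coreNodes)
    (hv : (Q.graph.deleteEdges Q.coreEdges).Reachable q v) (hne : v ≠ q) : v ∉ Q.outputs := by
  classical
  intro hvo
  obtain ⟨o, ho, w, hw⟩ := exists_walk_coreEdges hq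
  obtain ⟨W, hW⟩ := hv.exists_isPath
  cases W with
  | nil => exact hne rfl
  | @cons _ x _ hqx W =>
    rw [SimpleGraph.deleteEdges_adj] at hqx
    rw [SimpleGraph.Walk.cons_isPath_iff] at hW
    -- The first edge from `q` towards `v` is a bridge, with an output node `o` on the side of `q`
    -- and `v` on the other. If `v` were an output node, the path from `o` to `v` would have to use
    -- this edge, making it a core edge.
    have hbridge := SimpleGraph.isAcyclic_iff_forall_adj_isBridge.1 hQ.isAcyclic hqx.1
    rw [SimpleGraph.isBridge_iff] at hbridge
    have h1 : (Q.graph.deleteEdges {s(q, x)}).Reachable o q :=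
      ⟨w.toDeleteEdges _ fun e he h => hqx.2 (by
        rw [Set.mem_singleton_iff] at h; exact h ▸ hw e he)⟩
    have h2 : (Q.graph.deleteEdges {s(q, x)}).Reachable x v := by
      refine ⟨(W.mapLe (SimpleGraph.deleteEdges_le _)).toDeleteEdges _ fun e he h => ?_⟩
      rw [Set.mem_singleton_iff] at h
      subst h
      rw [SimpleGraph.Walk.edges_mapLe_eq_edges] at he
      exact hW.2 (W.fst_mem_support_of_mem_edges he)
    obtain ⟨p, hp⟩ := ((w.reachable.trans hqx.1.reachable).trans
      (W.mapLe (SimpleGraph.deleteEdges_le _)).reachable).exists_isPath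
    have hmem : s(q, x) ∈ p.edges := by
      by_contra hn
      have h3 : (Q.graph.deleteEdges {s(q, x)}).Reachable o v :=
        ⟨p.toDeleteEdges _ fun e he h => hn (by rw [Set.mem_singleton_iff] at h; exact h ▸ he)⟩
      exact hbridge ((h1.symm.trans h3).trans h2.symm)
    exact hqx.2 ⟨o, ho, v, hvo, p, hp, hmem⟩

theorem mem_nodes_of_mem_coreNodes {Q : Query Tag} {q : ℕ} (hq : q ∈ Q.coreNodes) :
    q ∈ Q.nodes := by
  classical
  simp only [coreNodes, Finset.mem_filter] at hq
  exact hq.1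

theorem mem_coreNodes_of_mem_coreChildren {Q : Query Tag} {q c : ℕ} (h : c ∈ Q.coreChildren q) :
    c ∈ Q.coreNodes := by
  classical
  simp only [coreChildren, Finset.mem_sort, Finset.mem_filter] at h
  exact h.1

theorem IsTPQ.coreRoot_mem {Q : Query Tag} (hQ : Q.IsTPQ) : Q.coreRoot ∈ Q.coreNodes := by
  classical
  obtain ⟨o, ho⟩ := hQ.outputs_nonempty
  have hne : (Q.coreNodes : Set ℕ).Nonempty :=
    ⟨o, by simp [coreNodes, hQ.outputs_subset ho, ho]⟩
  exact Nat.sInf_mem hne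

theorem mem_constraining {Q : Query Tag} {q v : ℕ} : v ∈ (Q.constraining q).nodes ↔
    v ∈ Q.nodes ∧ (v = q ∨ v ∉ Q.outputs ∧
      (Q.graph.deleteEdges Q.coreEdges).Reachable q v) := by
  classical
  simp only [constraining, Finset.mem_filter]

/-- All vertices of a connection by non-core edges are themselves in the subquery, since none of
them except possibly `q` is an output node. -/
theorem IsTPQ.constraining_reachable {Q : Query Tag} (hQ : Q.IsTPQ) {q : ℕ}
    (hq : q ∈ Q.coreNodes) {v : ℕ} (hv : (Q.graph.deleteEdges Q.coreEdges).Reachable q v) :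
    (Q.constraining q).graph.Reachable q v := by
  have hmem : ∀ x ∈ Q.nodes, (Q.graph.deleteEdges Q.coreEdges).Reachable q x →
      x ∈ (Q.constraining q).nodes := fun x hx hr => mem_constraining.2 ⟨hx, by
    by_cases hxq : x = q
    · exact .inl hxq
    · exact .inr ⟨hQ.not_mem_outputs hq hr hxq, hr⟩⟩
  rw [SimpleGraph.reachable_iff_reflTransGen] at hv
  induction hv with
  | refl => rfl
  | @tail x y hx hxy ih =>
    have hx' := (SimpleGraph.reachable_iff_reflTransGen _ _).2 hx
    have hy' := hx'.trans hxy.reachable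
    have hadj := ((SimpleGraph.deleteEdges_adj ..).1 hxy).1
    refine ih.trans (SimpleGraph.Adj.reachable ?_)
    exact ⟨hmem x hadj.1 hx', hmem y hadj.2.1 hy', hadj.2.2⟩

theorem coreEdges_constraining (Q : Query Tag) (q : ℕ) : (Q.constraining q).coreEdges = ∅ := by
  ext e
  simp only [coreEdges, constraining, Finset.mem_singleton, Set.mem_ofPred_eq,
    Set.mem_empty_iff_false, iff_false]
  rintro ⟨o₁, rfl, o₂, rfl, p, hp, he⟩
  rw [SimpleGraph.Walk.eq_nil_iff_nil.2 (SimpleGraph.Walk.isPath_iff_nil.1 hp)] at he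
  simp at he

/-- Planning `Π_q` as a query forms the constraining subquery once more; idempotence identifies the
result with the subplan used for `Q`. -/
theorem IsTPQ.constraining_constraining {Q : Query Tag} (hQ : Q.IsTPQ) {q : ℕ}
    (hq : q ∈ Q.coreNodes) : (Q.constraining q).constraining q = Q.constraining q := by
  have hn : ((Q.constraining q).constraining q).nodes = (Q.constraining q).nodes := by
    ext v
    rw [mem_constraining, coreEdges_constraining, SimpleGraph.deleteEdges_empty,
      and_iff_left_iff_imp]
    intro hv
    rcases (mem_constraining.1 hv).2 with rfl | ⟨_, hr⟩
    · exact .inl rfl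
    · refine or_iff_not_imp_left.2 fun hne => ⟨?_, hQ.constraining_reachable hq hr⟩
      simpa [constraining] using hne
  exact congrArg (fun s => (⟨s, Q.parent, Q.rel, Q.tag, {q}⟩ : Query Tag)) hn

theorem coreNodes_constraining {Q : Query Tag} {q : ℕ} (hq : q ∈ Q.nodes) :
    (Q.constraining q).coreNodes = {q} := by
  classical
  ext v
  rw [coreNodes, Finset.mem_filter, mem_constraining, Finset.mem_singleton]
  constructor
  · rintro ⟨_, h | ⟨o₁, h₁, o₂, h₂, p, hp, hv⟩⟩
    · simpa [constraining] using h
    · obtain rfl : o₁ = q := by simpa [constraining] using h₁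
      obtain rfl : o₂ = o₁ := by simpa [constraining] using h₂
      rw [SimpleGraph.Walk.eq_nil_iff_nil.2 (SimpleGraph.Walk.isPath_iff_nil.1 hp)] at hv
      simpa using hv
  · rintro rfl
    exact ⟨⟨hq, .inl rfl⟩, .inl (by simp [constraining])⟩

/-- The plan of a constraining subquery. -/
theorem IsTPQ.plan_constraining {Q : Query Tag} (hQ : Q.IsTPQ) (ord : NeighborOrder) {q : ℕ}
    (hq : q ∈ Q.coreNodes) : (Q.constraining q).plan ord = Q.consPlan ord q := by
  have hqn := mem_nodes_of_mem_coreNodes hq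
  have hroot : (Q.constraining q).coreRoot = q := by
    rw [coreRoot, coreNodes_constraining hqn]; simp
  have hchildren : (Q.constraining q).coreChildren q = [] := by
    rw [coreChildren, coreNodes_constraining hqn, Finset.filter_eq_empty_iff.2]
    · simp
    · intro c hc h
      rw [Finset.mem_singleton.1 hc] at h
      exact lt_irrefl _ (hQ.parent_lt hqn hqn h)
  have hcons : (Q.constraining q).consPlan ord q = Q.consPlan ord q := by
    rw [consPlan, hQ.constraining_constraining hq, consPlan]
  rw [plan, hroot]
  cases (Q.constraining q).nodes.card with
  | zero => rw [buildCore, hcons]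
  | succ n => rw [buildCore, hchildren, List.foldl_nil, hcons]

variable [DecidableEq Tag]

theorem stream_length_le_inputSize {Q : Query Tag} (D : XTree Tag) {q : ℕ} (hq : q ∈ Q.nodes) :
    (D.stream (Q.tag q)).length ≤ Q.inputSize D :=
  Finset.single_le_sum (f := fun v => (D.stream (Q.tag v)).length) (fun _ _ => Nat.zero_le _) hq

theorem inputSize_constraining_le (Q : Query Tag) (D : XTree Tag) (q : ℕ) :
    (Q.constraining q).inputSize D ≤ Q.inputSize D :=
  Finset.sum_le_sum_of_subset fun _ hv => (mem_constraining.1 hv).1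

/-- An output match of a query with the single output node `q` is determined by the image of `q`.
This turns the output term in (i) into input size. -/
theorem outputSize_constraining_le {Q : Query Tag} (D : XTree Tag) {q : ℕ} (hq : q ∈ Q.nodes) :
    (Q.constraining q).outputSize D ≤ (D.stream (Q.tag q)).length := by
  classical
  have hout : q ∈ (Q.constraining q).outputs := by simp [constraining]
  calc (Q.constraining q).outputSize D
      ≤ ((D.stream (Q.tag q)).toFinset : Set Label).ncard := by
        refine Set.ncard_le_ncard_of_injOn (fun f => f ⟨q, hout⟩) ?_ ?_ (Finset.finite_toSet _)
        · rintro f ⟨m, hm, hf⟩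
          simp only [hf, List.coe_toFinset, Set.mem_ofPred_eq]
          exact hm.1 q (mem_constraining.2 ⟨hq, .inl rfl⟩)
        · intro f _ g _ hfg
          funext ⟨v, hv⟩
          obtain rfl : v = q := by simpa [constraining] using hv
          exact hfg
    _ ≤ _ := by
        rw [Set.ncard_coe_finset]
        exact List.toFinset_card_le _

end Query

/-! ## Plans of queries whose core is a path -/

theorem length_project_le (t : Tuple) : ∀ M : Mask, (project M t).length ≤ t.length := by
  induction t with
  | nil => intro M; simp [project]
  | cons x t ih =>
    intro M
    have := ih fun c => M (c + 1)
    rw [project]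
    split_ifs <;> simp <;> omega

theorem project_none (t : Tuple) : project (fun _ => false) t = [] := by
  induction t with
  | nil => rfl
  | cons x t ih => simpa [project] using ih

theorem project_all (t : Tuple) : project Mask.all t = t := by
  induction t with
  | nil => rfl
  | cons x t ih => exact congrArg (List.cons x) ih

theorem length_project_first_le (t : Tuple) : (project Mask.first t).length ≤ 1 := by
  cases t with
  | nil => simp [project]
  | cons x t => simp [project, Mask.first, project_none]

theorem length_project_first {t : Tuple} (h : 1 ≤ t.length) :
    (project Mask.first t).length = 1 := by
  cases t with
  | nil => simp at h
  | cons x t => simp [project, Mask.first, project_none]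

/-- The next join of a chain is on column 1. That column holds the new node only because the
projection of a nonempty tuple contributes exactly one label. -/
theorem project_first_append_col {a d : Tuple} (ha : 1 ≤ a.length) :
    Tuple.col (project Mask.first a ++ project Mask.all d) 1 = d.col 0 := by
  obtain ⟨x, hx⟩ := List.length_eq_one_iff.1 (length_project_first ha)
  rw [hx, project_all]
  simp [Tuple.col]

section
variable {Tag : Type*} [DecidableEq Tag]

/-- The plan delivers on `D`, within the given time and space, at most `N` tuples, of at most `k`
columns each. -/
def Plan.Linear (D : XTree Tag) (N T M k : ℕ) (P : Plan Tag) : Prop :=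
  ∃ L, (P.exec D).Delivers T M L ∧ L.length ≤ N ∧ ∀ t ∈ L, t.length ≤ k

/-- The plan delivers on `D`, within the given time and space, at most `N` tuples, of one or two
columns each, whose labels in column `i` are disjoint and in document order. -/
def Plan.Disjoint (D : XTree Tag) (N T M i : ℕ) (P : Plan Tag) : Prop :=
  ∃ L, (P.exec D).Delivers T M L ∧ L.length ≤ N ∧ (∀ t ∈ L, 1 ≤ t.length ∧ t.length ≤ 2) ∧
    L.Pairwise (EndsBefore i)

theorem Plan.Disjoint.linear {D : XTree Tag} {N T M i : ℕ} {P : Plan Tag}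
    (h : P.Disjoint D N T M i) : P.Linear D N T M 2 := by
  obtain ⟨L, hL, hN, hk, _⟩ := h
  exact ⟨L, hL, hN, fun t ht => (hk t ht).2⟩

theorem Plan.Linear.mono {D : XTree Tag} {N T T' M M' k k' : ℕ} {P : Plan Tag}
    (h : P.Linear D N T M k) (hT : T ≤ T') (hM : M ≤ M') (hk : k ≤ k') :
    P.Linear D N T' M' k' := by
  obtain ⟨L, hL, hN, hk'⟩ := h
  exact ⟨L, hL.mono hT hM, hN, fun t ht => (hk' t ht).trans hk⟩

/-- A stack-based join whose first input has disjoint labels in the join column. -/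
theorem Plan.Disjoint.join {D : XTree Tag} {N T M T' M' i k k' : ℕ} {Pa Pd P : Plan Tag}
    {O : BinOp} {out : Tuple → Tuple → Tuple} (hP : P.exec D = Cursor.binary O (Pa.exec D) (Pd.exec D))
    (hO : ∀ {La : List Tuple} (Ld : List Tuple), La.Pairwise (EndsBefore i) →
      (∀ t ∈ La, t.length ≤ 2) → O.JoinsOnce (2 + 1) out O.init [] La Ld)
    (hout : ∀ a d, a.length ≤ 2 → d.length ≤ k → (out a d).length ≤ k')
    (ha : Pa.Disjoint D N T M i) (hd : Pd.Linear D N T' M' k) :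
    P.Linear D N (T + T' + (5 * N + 1)) (M + M' + (k + 6)) k' := by
  obtain ⟨La, hLa, hNa, hka, hpa⟩ := ha
  obtain ⟨Ld, hLd, hNd, hkd⟩ := hd
  obtain ⟨Z, hZ, hs, hm⟩ := hLa.join hLd (fun t ht => (hka t ht).2) hkd
    (hO Ld hpa fun t ht => (hka t ht).2)
  refine ⟨_, (hP ▸ hZ).mono (by omega) (by omega), ?_, ?_⟩
  · have := hs.length_le
    simp only [List.length_map] at this ⊢
    omega
  · simp only [List.mem_map]
    rintro _ ⟨p, hp, rfl⟩
    exact hout _ _ (hka _ (hm p hp)).2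
      (hkd _ (hs.subset (List.mem_map_of_mem hp)))

theorem Plan.Disjoint.joinDesc {D : XTree Tag} {N T M T' M' i k : ℕ} {Pa Pd : Plan Tag}
    (ha : Pa.Disjoint D N T M i) (hd : Pd.Linear D N T' M' k) (j : ℕ) (α : Rel) :
    (Plan.joinDesc Mask.first Mask.all i j α Pa Pd).Linear D N (T + T' + (5 * N + 1))
      (M + M' + (k + 6)) (k + 1) := by
  refine ha.join (by rw [Plan.exec]) stackTreeDesc_joinsOnce (fun a d _ hd => ?_) hd
  have := length_project_first_le a
  rw [List.length_append, project_all]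
  omega

theorem Plan.Disjoint.joinAnc {D : XTree Tag} {N T M T' M' i k : ℕ} {Pa Pd : Plan Tag}
    (ha : Pa.Disjoint D N T M i) (hd : Pd.Linear D N T' M' k) (Ma Md : Mask) (j : ℕ) (α : Rel) :
    (Plan.joinAnc Ma Md i j α Pa Pd).Linear D N (T + T' + (5 * N + 1))
      (M + M' + (k + 6)) (k + 2) := by
  refine ha.join (by rw [Plan.exec]) stackTreeAnc_joinsOnce (fun a d ha hd => ?_) hd
  have := length_project_le a Ma
  have := length_project_le d Md
  rw [List.length_append]
  omega

theorem Plan.Disjoint.joinAncSrt {D : XTree Tag} {N T M T' M' i k : ℕ} {Pa Pd : Plan Tag}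
    (ha : Pa.Disjoint D N T M i) (hd : Pd.Linear D N T' M' k) (Ma Md : Mask) (j : ℕ) (α : Rel)
    (c : ℕ) : (Plan.joinAncSrt Ma Md i j α c Pa Pd).Linear D N (T + T' + (5 * N + 1))
      (M + M' + (k + 6)) (k + 2) := by
  refine ha.join (by rw [Plan.exec]) stackTreeAnc_joinsOnce (fun a d ha hd => ?_) hd
  have := length_project_le a Ma
  have := length_project_le d Md
  rw [List.length_append]
  omega

/-- Each tuple of the second input is used at most once and in order, so column 1 of the result
inherits disjointness from the stream `T₂`, and the result can serve as first input of the next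
join. -/
theorem Plan.Disjoint.joinDesc_disjoint {D : XTree Tag} {N T M T' M' i : ℕ} {Pa Pd : Plan Tag}
    {T₂ : List Label} (ha : Pa.Disjoint D N T M i) {Ld : List Tuple}
    (hd : (Pd.exec D).Delivers T' M' Ld) (hs : Ld.Sublist (T₂.map fun x => [x]))
    (hT : T₂.Pairwise fun a b => a.right < b.left) (hN : T₂.length ≤ N) (α : Rel) :
    (Plan.joinDesc Mask.first Mask.all i 0 α Pa Pd).Disjoint D N (T + T' + (5 * N + 1))
      (M + M' + 7) 1 := by
  obtain ⟨La, hLa, hNa, hka, hpa⟩ := ha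
  have hkd : ∀ t ∈ Ld, t.length = 1 := fun t ht => by
    obtain ⟨x, _, rfl⟩ := List.mem_map.1 (hs.subset ht)
    rfl
  have hNd : Ld.length ≤ N := by simpa using hs.length_le.trans (by simpa using hN)
  obtain ⟨Z, hZ, hZs, hm⟩ := hLa.join hd (fun t ht => (hka t ht).2) (fun t ht => (hkd t ht).le)
    (stackTreeDesc_joinsOnce (j := 0)
      (test := fun a d => decide (α.Holds (a.col i) (d.col 0)))
      (out := fun a d => project Mask.first a ++ project Mask.all d)
      Ld hpa fun t ht => (hka t ht).2)
  refine ⟨_, hZ.mono (by omega) (by omega), ?_, ?_, ?_⟩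
  · have := hZs.length_le
    simp only [List.length_map] at this ⊢
    omega
  · simp only [List.mem_map]
    rintro _ ⟨p, hp, rfl⟩
    have h1 := length_project_first (hka _ (hm p hp)).1
    have h2 := hkd _ (hZs.subset (List.mem_map_of_mem hp))
    rw [List.length_append, project_all]
    omega
  · rw [List.pairwise_map]
    have hp := ((pairwise_endsBefore_singletons hT).sublist hs).sublist hZs
    rw [List.pairwise_map] at hp
    refine hp.imp_of_mem fun {a b} ha hb hab => ?_
    rw [EndsBefore, project_first_append_col (hka _ (hm a ha)).1,
      project_first_append_col (hka _ (hm b hb)).1]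
    exact hab

namespace Query

/-- The plans of the constraining subqueries of all query core nodes run within time `B` and space
`S`, and deliver sublists of non-recursive streams with at most `N` elements. -/
structure CoreBounds (ord : NeighborOrder) (Q : Query Tag) (D : XTree Tag) (N B S : ℕ) : Prop where
  delivers : ∀ q ∈ Q.coreNodes, ∃ L, ((Q.consPlan ord q).exec D).Delivers B S L ∧
    L.Sublist ((D.stream (Q.tag q)).map fun x => [x])
  pairwise : ∀ q ∈ Q.coreNodes, (D.stream (Q.tag q)).Pairwise fun a b => a.right < b.left
  length_le : ∀ q ∈ Q.coreNodes, (D.stream (Q.tag q)).length ≤ N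

theorem CoreBounds.disjoint {ord : NeighborOrder} {Q : Query Tag} {D : XTree Tag} {N B S : ℕ}
    (h : Q.CoreBounds ord D N B S) {q : ℕ} (hq : q ∈ Q.coreNodes) :
    (Q.consPlan ord q).Disjoint D N B S 0 := by
  obtain ⟨L, hL, hs⟩ := h.delivers q hq
  refine ⟨L, hL, ?_, ?_, (pairwise_endsBefore_singletons (h.pairwise q hq)).sublist hs⟩
  · have := h.length_le q hq
    have := hs.length_le
    simp only [List.length_map] at this
    omega
  · intro t ht
    obtain ⟨x, _, rfl⟩ := List.mem_map.1 (hs.subset ht)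
    simp

/-- The plans built for a query core that is a path. -/
theorem CoreBounds.buildCore_buildChain {ord : NeighborOrder} {Q : Query Tag} {D : XTree Tag}
    {N B S K : ℕ} (h : Q.CoreBounds ord D N B S) (hpath : Q.CoreIsPath) :
    ∀ f, 3 * f + 4 ≤ K →
      (∀ q ∈ Q.coreNodes, (Q.buildCore ord f q).Linear D N ((2 * f + 1) * (B + (5 * N + 1)))
        ((2 * f + 1) * (S + (K + 6))) (3 * f + 2)) ∧
      ∀ R i d T M, R.Disjoint D N T M i →
        (Q.buildChain ord f R i d).Linear D N (T + (2 * f + 1) * (B + (5 * N + 1)))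
          (M + (2 * f + 1) * (S + (K + 6))) (3 * f + 3) := by
  intro f
  induction f with
  -- The bounds hold for any fuel, so it need not be shown that the fuel suffices. `K` is kept fixed
  -- and dominates all tuple widths that occur, which makes the cost of one level uniform.
  | zero =>
    intro hK
    constructor
    · intro q hq
      rw [buildCore]
      exact (h.disjoint hq).linear.mono (by omega) (by omega) (by omega)
    · intro R i d T M hR
      rw [buildChain]
      exact hR.linear.mono (by omega) (by omega) (by omega)
  | succ f ih =>
    intro hK
    obtain ⟨ihcore, ihchain⟩ := ih (by omega)
    -- Two units per level: when the child is not an output node, a core step runs two constraining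
    -- plans, that of `q` and the one starting the chain.
    have hmul : ∀ x : ℕ, (2 * (f + 1) + 1) * x = (2 * f + 1) * x + x + x := fun x => by ring
    simp only [hmul]
    constructor
    · intro q hq
      have hP := h.disjoint hq
      rw [buildCore]
      rcases hc : Q.coreChildren q with _ | ⟨c, _ | ⟨c', l⟩⟩
      · exact hP.linear.mono (by omega) (by omega) (by omega)
      · have hcc : c ∈ Q.coreNodes := mem_coreNodes_of_mem_coreChildren (q := q) (by simp [hc])
        simp only [List.foldl_cons, List.foldl_nil]
        split_ifs
        · exact (hP.joinAnc (ihcore c hcc) _ _ _ _).mono (by omega) (by omega) (by omega)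
        · exact (hP.joinAncSrt (ihchain _ 0 c _ _ (h.disjoint hcc)) _ _ _ _ _).mono
            (by omega) (by omega) (by omega)
      · have := hpath q hq
        simp [hc] at this
    · intro R i d T M hR
      rw [buildChain]
      rcases hc : (Q.coreChildren d).head? with _ | d'
      · exact hR.linear.mono (by omega) (by omega) (by omega)
      · have hd' : d' ∈ Q.coreNodes :=
          mem_coreNodes_of_mem_coreChildren (q := d) (List.mem_of_mem_head? hc)
        dsimp only
        split_ifs
        · exact (hR.joinDesc (ihcore d' hd') 0 _).mono (by omega) (by omega) (by omega)
        · obtain ⟨L, hL, hs⟩ := h.delivers d' hd'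
          exact (ihchain _ 1 d' _ _ (hR.joinDesc_disjoint hL hs (h.pairwise d' hd')
            (h.length_le d' hd') _)).mono (by omega) (by omega) (by omega)

theorem IsTPQ.coreBounds {Q : Query Tag} (hQ : Q.IsTPQ) (ord : NeighborOrder) {D : XTree Tag}
    {C : ℕ} (hrec : ∀ q ∈ Q.coreNodes, ¬ IsRecursive (D.stream (Q.tag q)))
    (hC : ∀ q ∈ Q.coreNodes, (((Q.constraining q).plan ord).exec D).TimeLE
        (C * ((Q.constraining q).inputSize D + (Q.constraining q).outputSize D + 1)) ∧
      (((Q.constraining q).plan ord).exec D).SpaceLE (C * D.depth)) :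
    Q.CoreBounds ord D (Q.inputSize D) (C * (2 * Q.inputSize D + 1)) (C * D.depth) where
  delivers q hq := by
    have hqn := mem_nodes_of_mem_coreNodes hq
    obtain ⟨hT, hM⟩ := hC q hq
    rw [hQ.plan_constraining ord hq] at hT hM
    obtain ⟨L, hL⟩ := Cursor.exists_delivers _ hT hM
    refine ⟨L, hL.mono (Nat.mul_le_mul_left C ?_) le_rfl, ?_⟩
    · have h1 := Q.inputSize_constraining_le D q
      have h2 := outputSize_constraining_le (Q := Q) D hqn
      have h3 := stream_length_le_inputSize (Q := Q) D hqn
      omega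
    -- The list of the complete run is the prefix emitted in its `T` steps, so the statement on
    -- prefixes applies.
    · obtain ⟨T, _, hY⟩ := hL
      rw [← hY.emits_eq]
      exact (Q.constraining q).buildCons_filters ord D q (D.stream_pairwise _ (hrec q hq)) _ _ T
  pairwise q hq := D.stream_pairwise _ (hrec q hq)
  length_le q hq := stream_length_le_inputSize D (mem_nodes_of_mem_coreNodes hq)

end Query

end

end TwigJoin

theorem theorem2 {Tag : Type*} [DecidableEq Tag] (ord : TwigJoin.NeighborOrder)
    (Q : TwigJoin.Query Tag) (hQ : Q.IsTPQ) (hout : 2 ≤ Q.outputs.card)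
    (𝒟 : Set (TwigJoin.XTree Tag))
    (hcons : ∀ q ∈ Q.coreNodes, (Q.constraining q).Optimal ord 𝒟)
    (hpath : Q.CoreIsPath)
    (hrec : ∀ D ∈ 𝒟, ∀ q ∈ Q.coreNodes, ¬ TwigJoin.IsRecursive (D.stream (Q.tag q))) :
    Q.Optimal ord 𝒟 := by
  choose! c hc using hcons
  -- The constants in (i) depend on the core node; their sum serves for all of them.
  set C := ∑ q ∈ Q.coreNodes, c q with hCdef
  have hcC : ∀ q ∈ Q.coreNodes, c q ≤ C := fun q hq =>
    Finset.single_le_sum (f := c) (fun _ _ => Nat.zero_le _) hq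
  set F := Q.nodes.card
  set K := 3 * F + 4 with hK
  refine ⟨(2 * F + 1) * (2 * C + 5 + (K + 6)), fun D hD => ?_⟩
  have hbounds := hQ.coreBounds ord (C := C) (hrec D hD) fun q hq => by
    obtain ⟨hT, hM⟩ := hc q hq D hD
    refine ⟨TwigJoin.Cursor.after_none_of_le _ (Nat.mul_le_mul_right _ (hcC q hq)) hT, ?_⟩
    exact fun n s hs => (hM n s hs).trans (Nat.mul_le_mul_right _ (hcC q hq))
  obtain ⟨L, hL, -⟩ := (hbounds.buildCore_buildChain hpath F hK.ge).1 _ hQ.coreRoot_mem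
  -- Every document has depth at least 1, so the additive width term `K + 6` is absorbed into a
  -- multiple of the depth.
  have hdepth := D.one_le_depth
  constructor
  · refine TwigJoin.Cursor.after_none_of_le _ ?_ hL.timeLE
    rw [mul_assoc]
    refine Nat.mul_le_mul_left _ ?_
    calc C * (2 * Q.inputSize D + 1) + (5 * Q.inputSize D + 1)
        ≤ (2 * C + 5) * (Q.inputSize D + 1) := by nlinarith
      _ ≤ _ := Nat.mul_le_mul (by omega) (by omega)
  · refine fun n s hs => (hL.spaceLE n s hs).trans ?_
    rw [mul_assoc]
    refine Nat.mul_le_mul_left _ ?_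
    nlinarith
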